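/- Let $L,\Lambda,\rho,J>0$. Write $H^n(0,L)$ for the Sobolev spaces of complex-valued functions and, for $n\ge 2$, $\tilde H^n_0(0,L)=\{f\in H^n(0,L): f(0)=f'(0)=0\}$. Let $\tilde{\mathcal X}=\{[u,v,\xi]^\top: u\in\tilde H^2_0(0,L),\ v\in L^2(0,L),\ \xi\in\mathbb C\}$ be the Hilbert space with inner product $$\langle w_1,w_2\rangle=\frac{\Lambda}{2}\int_0^L u_1''\overline{u_2''}\,dx+\frac{\rho}{2}\int_0^L v_1\overline{v_2}\,dx+\frac{1}{2J}\xi_1\overline{\xi_2},$$ and let $\mathcal B[u,v,\xi]^\top=[v,\ -\tfrac{\Lambda}{\rho}u'''',\ -\Lambda u''(L)]^\top$ with domain $$D(\mathcal B)=\{[u,v,\xi]^\top\in\tilde{\mathcal X}: u\in\tilde H^4_0(0,L),\ v\in\tilde H^2_0(0,L),\ \xi=Jv'(L),\ u'''(L)=0\}.$$ Then $\mathcal B$ is (densely defined and) skew-adjoint, and it has compact resolvent. Its spectrum consists entirely of isolated eigenvalues, has no accumulation point in $\mathbb C$, and can be enumerated without repetition as $\{\mu_n\}_{n\in\mathbb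 Z\setminus\{0\}}\subset i\mathbb R$ with $\mu_{-n}=\overline{\mu_n}$. Every eigenspace $\ker(\mathcal B-\mu_n)$ is one-dimensional. For each $n\neq0$ there is a real-valued function $u_n\in\tilde H^4_0(0,L)$, with $u_{-n}=u_n$, which is up to scalar multiples the unique nontrivial solution in $\tilde H^4_0(0,L)$ of $$\rho\mu_n^2u_n+\Lambda u_n''''=0,\qquad u_n'''(L)=0,\qquad J\mu_n^2u_n'(L)+\Lambda u_n''(L)=0,$$ scaled so that $\Phi_n=[u_n,\ \mu_nu_n,\ \mu_nJu_n'(L)]^\top$ has norm $1$ in $\tilde{\mathcal X}$. The vector $\Phi_n$ spans $\ker(\mathcal B-\mu_n)$, and $\{\Phi_n\}_{n\in\mathbb Z\setminus\{0\}}$ is an orthonormal basis of $\tilde{\mathcal X}$. -/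

import Mathlib

open MeasureTheory Set Filter Topology
open scoped ContDiff InnerProductSpace ComplexConjugate

noncomputable section

namespace EulerBernoulli

/-- The space `L²(0, L)` of complex-valued functions. -/
abbrev L2 (L : ℝ) : Type := Lp ℂ 2 (volume.restrict (Ioo 0 L))

/-- `φ` is a smooth function with compact support in `(0, L)`. -/
def IsTestFunction (L : ℝ) (φ : ℝ → ℝ) : Prop :=
  ContDiff ℝ ∞ φ ∧ HasCompactSupport φ ∧ tsupport φ ⊆ Ioo 0 L

/-- `g ∈ L²(0, L)` is the weak derivative of `f ∈ L²(0, L)`. -/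
def IsWeakDeriv {L : ℝ} (f g : L2 L) : Prop :=
  ∀ φ : ℝ → ℝ, IsTestFunction L φ →
    ∫ x in Ioo 0 L, deriv φ x • f x = -∫ x in Ioo 0 L, φ x • g x

theorem integrable_L2 {L : ℝ} (f : L2 L) : Integrable f (volume.restrict (Ioo 0 L)) :=
  (Lp.memLp f).integrable (by norm_num)

theorem integrable_smul_L2 {L : ℝ} (f : L2 L) {φ : ℝ → ℝ} (hφ : Continuous φ)
    (hs : HasCompactSupport φ) :
    Integrable (fun x => φ x • f x) (volume.restrict (Ioo 0 L)) := by
  obtain ⟨C, hC⟩ := hs.exists_bound_of_continuous hφ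
  exact (integrable_L2 f).bdd_smul C hφ.aestronglyMeasurable (Eventually.of_forall hC)

theorem IsTestFunction.integrable_smul {L : ℝ} {φ : ℝ → ℝ} (hφ : IsTestFunction L φ)
    (f : L2 L) : Integrable (fun x => φ x • f x) (volume.restrict (Ioo 0 L)) :=
  integrable_smul_L2 f hφ.1.continuous hφ.2.1

theorem IsTestFunction.integrable_deriv_smul {L : ℝ} {φ : ℝ → ℝ} (hφ : IsTestFunction L φ)
    (f : L2 L) : Integrable (fun x => deriv φ x • f x) (volume.restrict (Ioo 0 L)) :=
  integrable_smul_L2 f (hφ.1.continuous_deriv (by simp)) hφ.2.1.deriv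

theorem IsWeakDeriv.zero {L : ℝ} : IsWeakDeriv (0 : L2 L) 0 := by
  intro φ _
  have h := Lp.coeFn_zero ℂ 2 (volume.restrict (Ioo 0 L))
  rw [integral_congr_ae (g := fun _ => 0),
    integral_congr_ae (f := fun x => φ x • (0 : L2 L) x) (g := fun _ => 0)]
  · simp
  · filter_upwards [h] with x hx using by rw [hx]; simp
  · filter_upwards [h] with x hx using by rw [hx]; simp

theorem IsWeakDeriv.add {L : ℝ} {f g f' g' : L2 L} (h : IsWeakDeriv f g)
    (h' : IsWeakDeriv f' g') : IsWeakDeriv (f + f') (g + g') := by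
  intro φ hφ
  rw [integral_congr_ae (g := fun x => deriv φ x • f x + deriv φ x • f' x),
    integral_congr_ae (f := fun x => φ x • (g + g') x)
      (g := fun x => φ x • g x + φ x • g' x),
    integral_add (hφ.integrable_deriv_smul f) (hφ.integrable_deriv_smul f'),
    integral_add (hφ.integrable_smul g) (hφ.integrable_smul g'), h φ hφ, h' φ hφ]
  · ring
  · filter_upwards [Lp.coeFn_add g g'] with x hx using by rw [hx, Pi.add_apply, smul_add]
  · filter_upwards [Lp.coeFn_add f f'] with x hx using by rw [hx, Pi.add_apply, smul_add]

theorem IsWeakDeriv.smul {L : ℝ} {f g : L2 L} (c : ℂ) (h : IsWeakDeriv f g) :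
    IsWeakDeriv (c • f) (c • g) := by
  intro φ hφ
  rw [integral_congr_ae (g := fun x => c • (deriv φ x • f x)),
    integral_congr_ae (f := fun x => φ x • (c • g) x) (g := fun x => c • (φ x • g x)),
    integral_smul, integral_smul, h φ hφ, smul_neg]
  · filter_upwards [Lp.coeFn_smul c g] with x hx using by rw [hx, Pi.smul_apply, smul_comm]
  · filter_upwards [Lp.coeFn_smul c f] with x hx using by rw [hx, Pi.smul_apply, smul_comm]

/-- Fundamental lemma of the calculus of variations on `(0, L)`. -/
theorem eq_zero_of_test {L : ℝ} (f : ℝ → ℂ) (hf : IntegrableOn f (Ioo 0 L))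
    (h : ∀ φ : ℝ → ℝ, IsTestFunction L φ → ∫ x in Ioo 0 L, φ x • f x = 0) :
    f =ᵐ[volume.restrict (Ioo 0 L)] 0 := by
  have := IsOpen.ae_eq_zero_of_integral_contDiff_smul_eq_zero (μ := volume)
    (isOpen_Ioo (a := (0 : ℝ)) (b := L)) hf.locallyIntegrableOn (by
      intro φ h1 h2 h3
      rw [← h φ ⟨h1, h2, h3⟩, setIntegral_eq_integral_of_forall_compl_eq_zero]
      intro x hx
      rw [image_eq_zero_of_notMem_tsupport (fun h => hx (h3 h)), zero_smul])
  exact (ae_restrict_iff' measurableSet_Ioo).2 this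

theorem IsWeakDeriv.unique {L : ℝ} {f g g' : L2 L} (h : IsWeakDeriv f g)
    (h' : IsWeakDeriv f g') : g = g' := by
  rw [← sub_eq_zero]
  apply Lp.ext
  refine EventuallyEq.trans ?_ (Lp.coeFn_zero ℂ 2 _).symm
  refine eq_zero_of_test _ (integrable_L2 _) fun φ hφ => ?_
  rw [integral_congr_ae (g := fun x => φ x • g x - φ x • g' x),
    integral_sub (hφ.integrable_smul g) (hφ.integrable_smul g')]
  · have := (h φ hφ).symm.trans (h' φ hφ)
    rw [neg_inj] at this
    rw [this, sub_self]
  · filter_upwards [Lp.coeFn_sub g g'] with x hx using by rw [hx, Pi.sub_apply, smul_sub]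

theorem exists_Icc_of_compact {L : ℝ} (hL : 0 < L) {K : Set ℝ} (hK : IsCompact K)
    (hKL : K ⊆ Ioo 0 L) : ∃ a b : ℝ, 0 < a ∧ a ≤ b ∧ b < L ∧ K ⊆ Icc a b := by
  have hK' : IsCompact (insert (L / 2) K) := hK.insert _
  have hsub : insert (L / 2) K ⊆ Ioo 0 L :=
    insert_subset ⟨by linarith, by linarith⟩ hKL
  obtain ⟨a, ha, ha'⟩ := hK'.exists_isLeast (insert_nonempty _ _)
  obtain ⟨b, hb, hb'⟩ := hK'.exists_isGreatest (insert_nonempty _ _)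
  exact ⟨a, b, (hsub ha).1, ha' hb, (hsub hb).2,
    fun x hx => ⟨ha' (mem_insert_of_mem _ hx), hb' (mem_insert_of_mem _ hx)⟩⟩

/-- A test function of mean zero is the derivative of a test function. -/
theorem exists_primitive_test {L : ℝ} (hL : 0 < L) {ψ : ℝ → ℝ} (hψ : IsTestFunction L ψ)
    (h0 : ∫ x, ψ x = 0) : ∃ Ψ, IsTestFunction L Ψ ∧ deriv Ψ = ψ := by
  obtain ⟨a, b, ha, hab, hb, hK⟩ := exists_Icc_of_compact hL hψ.2.1.isCompact hψ.2.2
  have hc := hψ.1.continuous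
  have hz : ∀ x, x ∉ Icc a b → ψ x = 0 := fun x hx =>
    image_eq_zero_of_notMem_tsupport (fun h => hx (hK h))
  have hd : ∀ x, HasDerivAt (fun x => ∫ t in a..x, ψ t) (ψ x) x := fun x =>
    intervalIntegral.integral_hasDerivAt_right (hc.intervalIntegrable _ _)
      hc.aestronglyMeasurable.stronglyMeasurableAtFilter hc.continuousAt
  have hderiv : deriv (fun x => ∫ t in a..x, ψ t) = ψ := funext fun x => (hd x).deriv
  have hsupp : Function.support (fun x => ∫ t in a..x, ψ t) ⊆ Icc a b := by
    intro x hx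
    by_contra hxn
    apply hx
    rcases lt_or_ge x a with h | h
    · show ∫ t in a..x, ψ t = 0
      rw [intervalIntegral.integral_symm, intervalIntegral.integral_of_le h.le,
        ← integral_Ioc_eq_integral_Ioo.symm, setIntegral_eq_zero_of_forall_eq_zero, neg_zero]
      exact fun t ht => hz t fun h' => absurd ht.2 (not_lt.2 h'.1)
    · have hbx : b < x := by
        by_contra h'
        exact hxn ⟨h, not_lt.1 h'⟩
      show ∫ t in a..x, ψ t = 0
      rw [intervalIntegral.integral_of_le h, ← integral_Icc_eq_integral_Ioc,
        setIntegral_eq_integral_of_forall_compl_eq_zero, h0]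
      exact fun t ht => hz t fun h' => ht ⟨h'.1, h'.2.trans hbx.le⟩
  refine ⟨fun x => ∫ t in a..x, ψ t, ⟨?_, ?_, ?_⟩, hderiv⟩
  · rw [contDiff_infty_iff_deriv, hderiv]
    exact ⟨fun x => (hd x).differentiableAt, hψ.1⟩
  · exact HasCompactSupport.of_support_subset_isCompact isCompact_Icc hsupp
  · exact (closure_minimal hsupp isClosed_Icc).trans
      (fun x hx => ⟨ha.trans_le hx.1, hx.2.trans_lt hb⟩)

/-- A function on `(0, L)` whose weak derivative is zero is constant. -/
theorem IsWeakDeriv.const_of_zero {L : ℝ} (hL : 0 < L) {f : L2 L} (h : IsWeakDeriv f 0) :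
    ∃ c : ℂ, f =ᵐ[volume.restrict (Ioo 0 L)] fun _ => c := by
  have h' : ∀ φ, IsTestFunction L φ → ∫ x in Ioo 0 L, deriv φ x • f x = 0 := by
    intro φ hφ
    rw [h φ hφ, neg_eq_zero, integral_congr_ae (g := fun _ => 0)]
    · simp
    · filter_upwards [Lp.coeFn_zero ℂ 2 (volume.restrict (Ioo 0 L))] with x hx using by rw [hx]; simp
  let B : ContDiffBump (L / 2) := ⟨L / 8, L / 4, by linarith, by linarith⟩
  have hη : IsTestFunction L (B.normed volume) := by
    refine ⟨B.contDiff_normed, B.hasCompactSupport_normed, ?_⟩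
    rw [B.tsupport_normed_eq, Real.closedBall_eq_Icc]
    intro x hx
    have h1 := hx.1
    have h2 := hx.2
    have e : B.rOut = L / 4 := rfl
    rw [e] at h1 h2
    exact ⟨by linarith, by linarith⟩
  refine ⟨∫ x in Ioo 0 L, B.normed volume x • f x, ?_⟩
  set c := ∫ x in Ioo 0 L, B.normed volume x • f x with hc
  have key : (fun x => f x - c) =ᵐ[volume.restrict (Ioo 0 L)] 0 := by
    refine eq_zero_of_test _ ((integrable_L2 f).sub (integrable_const c)) fun φ hφ => ?_
    have hφi : Integrable φ := hφ.1.continuous.integrable_of_hasCompactSupport hφ.2.1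
    have hηi : Integrable (B.normed volume) :=
      hη.1.continuous.integrable_of_hasCompactSupport hη.2.1
    set m := ∫ x, φ x with hm
    have hψ : IsTestFunction L (fun x => φ x - m * B.normed volume x) := by
      refine ⟨hφ.1.sub (contDiff_const.mul hη.1), hφ.2.1.sub hη.2.1.mul_left, ?_⟩
      refine (tsupport_sub _ _).trans (union_subset hφ.2.2 ?_)
      exact (tsupport_mul_subset_right).trans hη.2.2
    obtain ⟨Ψ, hΨ, hΨ'⟩ := exists_primitive_test hL hψ (by
      rw [integral_sub hφi (hηi.const_mul m), integral_const_mul, B.integral_normed]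
      simp [hm])
    have := h' Ψ hΨ
    rw [hΨ'] at this
    have e1 : ∫ x in Ioo 0 L, (φ x - m * B.normed volume x) • f x
        = (∫ x in Ioo 0 L, φ x • f x) - m • c := by
      have : m • c = ∫ x in Ioo 0 L, m • (B.normed volume x • f x) := by
        rw [hc, integral_smul]
      rw [this, ← integral_sub (hφ.integrable_smul f) (by
        exact (hη.integrable_smul f).smul m)]
      congr 1
      ext x
      simp [sub_mul, mul_assoc]
    have e2 : ∫ x in Ioo 0 L, φ x • (f x - c) = (∫ x in Ioo 0 L, φ x • f x) - m • c := by
      have : ∫ x in Ioo 0 L, φ x • c = m • c := by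
        rw [integral_smul_const, hm, setIntegral_eq_integral_of_forall_compl_eq_zero]
        exact fun x hx => image_eq_zero_of_notMem_tsupport (fun h => hx (hφ.2.2 h))
      rw [← this, ← integral_sub (hφ.integrable_smul f) (hφi.restrict.smul_const c)]
      congr 1
      ext x
      simp [mul_sub]
    rw [e2, ← e1, this]
  filter_upwards [key] with x hx
  exact sub_eq_zero.1 hx

/-- `F` is a representative of `f` that is continuous on the closed interval. -/
def IsContRep {L : ℝ} (f : L2 L) (F : ℝ → ℂ) : Prop :=
  ContinuousOn F (Icc 0 L) ∧ f =ᵐ[volume.restrict (Ioo 0 L)] F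

/-- Every `g ∈ L²(0, L)` has a primitive vanishing at `0`. -/
theorem exists_primitive {L : ℝ} (hL : 0 < L) (g : L2 L) :
    ∃ (f : L2 L) (F : ℝ → ℂ), IsWeakDeriv f g ∧ IsContRep f F ∧ F 0 = 0 := by
  have hgi : IntegrableOn g (Icc 0 L) := by
    rw [integrableOn_Icc_iff_integrableOn_Ioo]; exact integrable_L2 g
  set F : ℝ → ℂ := fun x => ∫ t in (0 : ℝ)..x, g t with hF
  have hFc : ContinuousOn F (Icc 0 L) := by
    have := intervalIntegral.continuousOn_primitive_interval (a := (0 : ℝ)) (b := L) (f := g)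
      (μ := volume) (by rwa [uIcc_of_le hL.le])
    rwa [uIcc_of_le hL.le] at this
  obtain ⟨C, hC⟩ := isCompact_Icc.exists_bound_of_continuousOn hFc
  have hFm : MemLp F 2 (volume.restrict (Ioo 0 L)) := by
    refine MemLp.of_bound ((hFc.mono Ioo_subset_Icc_self).aestronglyMeasurable
      measurableSet_Ioo) C ?_
    filter_upwards [ae_restrict_mem measurableSet_Ioo] with x hx
    exact hC x (Ioo_subset_Icc_self hx)
  refine ⟨hFm.toLp F, F, ?_, ⟨hFc, hFm.coeFn_toLp⟩, by simp [hF]⟩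
  intro φ hφ
  set ν := volume.restrict (Ioo (0 : ℝ) L) with hν
  have hdc : Continuous (deriv φ) := hφ.1.continuous_deriv (by simp)
  have hdi : Integrable (deriv φ) ν :=
    (hdc.integrable_of_hasCompactSupport hφ.2.1.deriv).restrict
  rw [integral_congr_ae (g := fun x => deriv φ x • F x)]
  swap
  · filter_upwards [hFm.coeFn_toLp] with x hx using by rw [hx]
  have hprod : Integrable (fun z : ℝ × ℝ => deriv φ z.1 • g z.2) (ν.prod ν) :=
    hdi.smul_prod (integrable_L2 g)
  have hS : MeasurableSet {z : ℝ × ℝ | z.2 ≤ z.1} :=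
    measurableSet_le measurable_snd measurable_fst
  have hind := hprod.indicator hS
  have hswap := integral_integral_swap
    (f := fun x t => ({z : ℝ × ℝ | z.2 ≤ z.1}).indicator
      (fun z : ℝ × ℝ => deriv φ z.1 • g z.2) (x, t)) hind
  have eL : ∀ x ∈ Ioo 0 L, ∫ t, ({z : ℝ × ℝ | z.2 ≤ z.1}).indicator
      (fun z : ℝ × ℝ => deriv φ z.1 • g z.2) (x, t) ∂ν = deriv φ x • F x := by
    intro x hx
    have : (fun t => ({z : ℝ × ℝ | z.2 ≤ z.1}).indicator
        (fun z : ℝ × ℝ => deriv φ z.1 • g z.2) (x, t))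
        = (Iic x).indicator (fun t => deriv φ x • g t) := by
      ext t
      simp [indicator]
    rw [this, integral_indicator measurableSet_Iic, integral_smul, hν,
      Measure.restrict_restrict measurableSet_Iic]
    have hset : Iic x ∩ Ioo 0 L = Ioc 0 x := by
      ext t
      simp only [mem_inter_iff, mem_Iic, mem_Ioo, mem_Ioc]
      exact ⟨fun h => ⟨h.2.1, h.1⟩, fun h => ⟨h.2, h.1, h.2.trans_lt hx.2⟩⟩
    rw [hset, hF]
    simp only
    rw [intervalIntegral.integral_of_le hx.1.le]
  have eR : ∀ t ∈ Ioo 0 L, ∫ x, ({z : ℝ × ℝ | z.2 ≤ z.1}).indicator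
      (fun z : ℝ × ℝ => deriv φ z.1 • g z.2) (x, t) ∂ν = -(φ t • g t) := by
    intro t ht
    have : (fun x => ({z : ℝ × ℝ | z.2 ≤ z.1}).indicator
        (fun z : ℝ × ℝ => deriv φ z.1 • g z.2) (x, t))
        = (Ici t).indicator (fun x => deriv φ x • g t) := by
      ext x
      simp [indicator]
    rw [this, integral_indicator measurableSet_Ici, integral_smul_const, hν,
      Measure.restrict_restrict measurableSet_Ici]
    have hset : Ici t ∩ Ioo 0 L = Ico t L := by
      ext x
      simp only [mem_inter_iff, mem_Ici, mem_Ioo, mem_Ico]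
      exact ⟨fun h => ⟨h.1, h.2.2⟩, fun h => ⟨h.1, ht.1.trans_le h.1, h.2⟩⟩
    rw [hset, integral_Ico_eq_integral_Ioo, ← integral_Ioc_eq_integral_Ioo,
      ← intervalIntegral.integral_of_le ht.2.le,
      intervalIntegral.integral_deriv_eq_sub
        (fun x _ => (hφ.1.differentiable (by simp)) x) (hdc.intervalIntegrable _ _)]
    have : φ L = 0 := image_eq_zero_of_notMem_tsupport
      (fun h => absurd (hφ.2.2 h).2 (lt_irrefl _))
    rw [this, zero_sub, neg_smul]
  calc ∫ x, deriv φ x • F x ∂ν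
      = ∫ x, ∫ t, ({z : ℝ × ℝ | z.2 ≤ z.1}).indicator
          (fun z : ℝ × ℝ => deriv φ z.1 • g z.2) (x, t) ∂ν ∂ν :=
        setIntegral_congr_fun measurableSet_Ioo fun x hx => (eL x hx).symm
    _ = ∫ t, ∫ x, ({z : ℝ × ℝ | z.2 ≤ z.1}).indicator
          (fun z : ℝ × ℝ => deriv φ z.1 • g z.2) (x, t) ∂ν ∂ν := hswap
    _ = ∫ t, -(φ t • g t) ∂ν := setIntegral_congr_fun measurableSet_Ioo eR
    _ = _ := integral_neg _

/-- Elements of `H¹(0, L)` have a continuous representative. -/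
theorem IsWeakDeriv.exists_contRep {L : ℝ} (hL : 0 < L) {f g : L2 L} (h : IsWeakDeriv f g) :
    ∃ F, IsContRep f F := by
  obtain ⟨p, P, hp, hP, -⟩ := exists_primitive hL g
  have h0 : IsWeakDeriv (f + (-1 : ℂ) • p) 0 := by
    have := h.add (hp.smul (-1))
    rwa [neg_one_smul ℂ g, add_neg_cancel] at this
  obtain ⟨c, hc⟩ := h0.const_of_zero hL
  refine ⟨fun x => c + P x, continuousOn_const.add hP.1, ?_⟩
  filter_upwards [hc, hP.2, Lp.coeFn_add f ((-1 : ℂ) • p), Lp.coeFn_smul (-1 : ℂ) p]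
    with x h1 h2 h3 h4
  rw [h3, Pi.add_apply, h4, Pi.smul_apply, h2] at h1
  rw [← h1]
  simp

theorem IsContRep.eqOn {L : ℝ} (hL : 0 < L) {f : L2 L} {F G : ℝ → ℂ} (hF : IsContRep f F)
    (hG : IsContRep f G) : EqOn F G (Icc 0 L) := by
  refine Measure.eqOn_Icc_of_ae_eq volume hL.ne ?_ hF.1 hG.1
  rw [← restrict_Ioo_eq_restrict_Icc]
  exact hF.2.symm.trans hG.2

/-- The Sobolev space `Hⁿ(0, L)` of complex-valued functions: all weak derivatives of order
at most `n` exist and belong to `L²(0, L)`. -/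
def sobolev (L : ℝ) : ℕ → Submodule ℂ (L2 L)
  | 0 => ⊤
  | n + 1 =>
    { carrier := {f | ∃ g ∈ sobolev L n, IsWeakDeriv f g}
      add_mem' := by
        rintro f f' ⟨g, hg, h⟩ ⟨g', hg', h'⟩
        exact ⟨g + g', add_mem hg hg', h.add h'⟩
      zero_mem' := ⟨0, zero_mem _, IsWeakDeriv.zero⟩
      smul_mem' := by
        rintro c f ⟨g, hg, h⟩
        exact ⟨c • g, Submodule.smul_mem _ c hg, h.smul c⟩ }

open Classical in
/-- The weak derivative of `f ∈ H¹(0, L)` (and `0` if `f ∉ H¹(0, L)`). The `k`-th weak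
derivative of `f` is the iterate `weakDeriv^[k] f`. -/
def weakDeriv {L : ℝ} (f : L2 L) : L2 L :=
  if h : ∃ g, IsWeakDeriv f g then h.choose else 0

open Classical in
/-- The value at `x ∈ [0, L]` of the continuous representative of `f` (and `0` if there is none).
Every `f ∈ H¹(0, L)` has a continuous representative, and it is unique on `[0, L]`. -/
def pointValue {L : ℝ} (f : L2 L) (x : ℝ) : ℂ :=
  if h : ∃ F, IsContRep f F then h.choose x else 0

theorem IsWeakDeriv.weakDeriv_eq {L : ℝ} {f g : L2 L} (h : IsWeakDeriv f g) :
    weakDeriv f = g := by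
  have h' : ∃ g, IsWeakDeriv f g := ⟨g, h⟩
  rw [weakDeriv, dif_pos h']
  exact h'.choose_spec.unique h

theorem IsContRep.pointValue_eq {L : ℝ} (hL : 0 < L) {f : L2 L} {F : ℝ → ℂ}
    (h : IsContRep f F) {x : ℝ} (hx : x ∈ Icc 0 L) : pointValue f x = F x := by
  have h' : ∃ F, IsContRep f F := ⟨F, h⟩
  rw [pointValue, dif_pos h']
  exact h'.choose_spec.eqOn hL h hx

theorem IsContRep.add {L : ℝ} {f g : L2 L} {F G : ℝ → ℂ} (hF : IsContRep f F)
    (hG : IsContRep g G) : IsContRep (f + g) (F + G) :=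
  ⟨hF.1.add hG.1, (Lp.coeFn_add f g).trans (hF.2.add hG.2)⟩

theorem IsContRep.smul {L : ℝ} {f : L2 L} {F : ℝ → ℂ} (c : ℂ) (hF : IsContRep f F) :
    IsContRep (c • f) (c • F) :=
  ⟨hF.1.const_smul c, (Lp.coeFn_smul c f).trans (hF.2.const_smul c)⟩

theorem sobolev_succ_le (L : ℝ) (n : ℕ) : sobolev L (n + 1) ≤ sobolev L n := by
  induction n with
  | zero => exact le_top
  | succ n ih =>
    rintro f ⟨g, hg, h⟩
    exact ⟨g, ih hg, h⟩

theorem isWeakDeriv_weakDeriv {L : ℝ} {n : ℕ} {f : L2 L} (hf : f ∈ sobolev L (n + 1)) :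
    IsWeakDeriv f (weakDeriv f) := by
  obtain ⟨g, -, h⟩ := hf
  rwa [h.weakDeriv_eq]

theorem weakDeriv_mem {L : ℝ} {n : ℕ} {f : L2 L} (hf : f ∈ sobolev L (n + 1)) :
    weakDeriv f ∈ sobolev L n := by
  obtain ⟨g, hg, h⟩ := hf
  rwa [h.weakDeriv_eq]

theorem iterate_weakDeriv_mem {L : ℝ} (n k : ℕ) {f : L2 L} (hf : f ∈ sobolev L (n + k)) :
    weakDeriv^[k] f ∈ sobolev L n := by
  induction k generalizing f with
  | zero => exact hf
  | succ k ih => exact ih (weakDeriv_mem hf)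

theorem iterate_weakDeriv_add {L : ℝ} (k : ℕ) {f g : L2 L} (hf : f ∈ sobolev L k)
    (hg : g ∈ sobolev L k) :
    weakDeriv^[k] (f + g) = weakDeriv^[k] f + weakDeriv^[k] g := by
  induction k generalizing f g with
  | zero => rfl
  | succ k ih =>
    rw [Function.iterate_succ_apply, Function.iterate_succ_apply, Function.iterate_succ_apply,
      ((isWeakDeriv_weakDeriv hf).add (isWeakDeriv_weakDeriv hg)).weakDeriv_eq]
    exact ih (weakDeriv_mem hf) (weakDeriv_mem hg)

theorem iterate_weakDeriv_smul {L : ℝ} (k : ℕ) (c : ℂ) {f : L2 L} (hf : f ∈ sobolev L k) :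
    weakDeriv^[k] (c • f) = c • weakDeriv^[k] f := by
  induction k generalizing f with
  | zero => rfl
  | succ k ih =>
    rw [Function.iterate_succ_apply, Function.iterate_succ_apply,
      ((isWeakDeriv_weakDeriv hf).smul c).weakDeriv_eq]
    exact ih (weakDeriv_mem hf)

theorem weakDeriv_add {L : ℝ} {f g : L2 L} (hf : f ∈ sobolev L 1) (hg : g ∈ sobolev L 1) :
    weakDeriv (f + g) = weakDeriv f + weakDeriv g :=
  iterate_weakDeriv_add 1 hf hg

theorem weakDeriv_smul {L : ℝ} (c : ℂ) {f : L2 L} (hf : f ∈ sobolev L 1) :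
    weakDeriv (c • f) = c • weakDeriv f :=
  iterate_weakDeriv_smul 1 c hf

theorem iterate_weakDeriv_zero {L : ℝ} (k : ℕ) : weakDeriv^[k] (0 : L2 L) = 0 := by
  have := iterate_weakDeriv_smul k 0 (zero_mem (sobolev L k))
  rwa [zero_smul, zero_smul] at this

theorem exists_contRep_of_mem {L : ℝ} (hL : 0 < L) {f : L2 L} (hf : f ∈ sobolev L 1) :
    ∃ F, IsContRep f F :=
  (isWeakDeriv_weakDeriv hf).exists_contRep hL

theorem pointValue_add {L : ℝ} (hL : 0 < L) {f g : L2 L} (hf : f ∈ sobolev L 1)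
    (hg : g ∈ sobolev L 1) {x : ℝ} (hx : x ∈ Icc 0 L) :
    pointValue (f + g) x = pointValue f x + pointValue g x := by
  obtain ⟨F, hF⟩ := exists_contRep_of_mem hL hf
  obtain ⟨G, hG⟩ := exists_contRep_of_mem hL hg
  rw [hF.pointValue_eq hL hx, hG.pointValue_eq hL hx, (hF.add hG).pointValue_eq hL hx,
    Pi.add_apply]

theorem pointValue_smul {L : ℝ} (hL : 0 < L) (c : ℂ) {f : L2 L} (hf : f ∈ sobolev L 1)
    {x : ℝ} (hx : x ∈ Icc 0 L) : pointValue (c • f) x = c * pointValue f x := by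
  obtain ⟨F, hF⟩ := exists_contRep_of_mem hL hf
  rw [hF.pointValue_eq hL hx, (hF.smul c).pointValue_eq hL hx, Pi.smul_apply, smul_eq_mul]

theorem pointValue_zero {L : ℝ} (hL : 0 < L) {x : ℝ} (hx : x ∈ Icc 0 L) :
    pointValue (0 : L2 L) x = 0 := by
  have := pointValue_smul hL 0 (zero_mem (sobolev L 1)) hx
  rwa [zero_smul, zero_mul] at this

/-- An `H¹` function with vanishing derivative and vanishing value at `0` is zero. -/
theorem eq_zero_of_weakDeriv_eq_zero {L : ℝ} (hL : 0 < L) {f : L2 L} (hf : f ∈ sobolev L 1)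
    (hd : weakDeriv f = 0) (h0 : pointValue f 0 = 0) : f = 0 := by
  have h := isWeakDeriv_weakDeriv hf
  rw [hd] at h
  obtain ⟨c, hc⟩ := h.const_of_zero hL
  have hrep : IsContRep f fun _ => c := ⟨continuousOn_const, hc⟩
  rw [hrep.pointValue_eq hL (left_mem_Icc.2 hL.le)] at h0
  apply Lp.ext
  filter_upwards [hc, Lp.coeFn_zero ℂ 2 (volume.restrict (Ioo 0 L))] with x h1 h2
  rw [h1, h2, h0, Pi.zero_apply]

/-- The physical parameters: length `L`, bending stiffness `Λ`, mass per length `ρ` of the beam,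
and moment of inertia `J` of the payload. -/
structure BeamParams where
  L : ℝ
  Λ : ℝ
  ρ : ℝ
  J : ℝ
  L_pos : 0 < L
  Λ_pos : 0 < Λ
  ρ_pos : 0 < ρ
  J_pos : 0 < J

theorem BeamParams.zero_mem (p : BeamParams) : (0 : ℝ) ∈ Icc 0 p.L := left_mem_Icc.2 p.L_pos.le

theorem BeamParams.L_mem (p : BeamParams) : p.L ∈ Icc 0 p.L := right_mem_Icc.2 p.L_pos.le

/-- `H̃²₀(0, L)`: the functions `f ∈ H²(0, L)` with `f = 0` and `f' = 0` at `0`. For `n ≥ 2` the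
space `H̃ⁿ₀(0, L)` consists of the elements of `H̃²₀(0, L)` that lie in `Hⁿ(0, L)`. -/
def clamped (p : BeamParams) : Submodule ℂ (L2 p.L) where
  carrier := {f | f ∈ sobolev p.L 2 ∧ pointValue f 0 = 0 ∧ pointValue (weakDeriv f) 0 = 0}
  add_mem' := by
    rintro f g ⟨hf, hf0, hf1⟩ ⟨hg, hg0, hg1⟩
    have hf' := sobolev_succ_le _ 1 hf
    have hg' := sobolev_succ_le _ 1 hg
    refine ⟨add_mem hf hg, ?_, ?_⟩
    · rw [pointValue_add p.L_pos hf' hg' p.zero_mem, hf0, hg0, add_zero]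
    · rw [weakDeriv_add hf' hg',
        pointValue_add p.L_pos (weakDeriv_mem hf) (weakDeriv_mem hg) p.zero_mem, hf1, hg1,
        add_zero]
  zero_mem' := ⟨zero_mem _, pointValue_zero p.L_pos p.zero_mem, by
    rw [IsWeakDeriv.zero.weakDeriv_eq, pointValue_zero p.L_pos p.zero_mem]⟩
  smul_mem' := by
    rintro c f ⟨hf, hf0, hf1⟩
    have hf' := sobolev_succ_le _ 1 hf
    refine ⟨Submodule.smul_mem _ c hf, ?_, ?_⟩
    · rw [pointValue_smul p.L_pos c hf' p.zero_mem, hf0, mul_zero]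
    · rw [weakDeriv_smul c hf', pointValue_smul p.L_pos c (weakDeriv_mem hf) p.zero_mem, hf1,
        mul_zero]

theorem eq_zero_of_clamped {p : BeamParams} {f : L2 p.L} (hf : f ∈ clamped p)
    (h : weakDeriv^[2] f = 0) : f = 0 := by
  obtain ⟨hf, h0, h1⟩ := hf
  have : weakDeriv f = 0 := eq_zero_of_weakDeriv_eq_zero p.L_pos (weakDeriv_mem hf) h h1
  exact eq_zero_of_weakDeriv_eq_zero p.L_pos (sobolev_succ_le _ 1 hf) this h0

theorem exists_clamped (p : BeamParams) (g : L2 p.L) :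
    ∃ f ∈ clamped p, weakDeriv^[2] f = g := by
  obtain ⟨f₁, F₁, h1, hF1, h10⟩ := exists_primitive p.L_pos g
  obtain ⟨f₂, F₂, h2, hF2, h20⟩ := exists_primitive p.L_pos f₁
  refine ⟨f₂, ⟨⟨f₁, ⟨g, trivial, h1⟩, h2⟩, ?_, ?_⟩, ?_⟩
  · rw [hF2.pointValue_eq p.L_pos p.zero_mem, h20]
  · rw [h2.weakDeriv_eq, hF1.pointValue_eq p.L_pos p.zero_mem, h10]
  · rw [Function.iterate_succ_apply, Function.iterate_one, h2.weakDeriv_eq, h1.weakDeriv_eq]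

/-- The complex energy space `X̃` of triples `[u, v, ξ]` with `u ∈ H̃²₀(0, L)`, `v ∈ L²(0, L)` and
`ξ ∈ ℂ`. -/
def EnergySpace (p : BeamParams) : Type := clamped p × L2 p.L × ℂ

namespace EnergySpace

variable {p : BeamParams}

instance : AddCommGroup (EnergySpace p) := inferInstanceAs (AddCommGroup (clamped p × L2 p.L × ℂ))

instance : Module ℂ (EnergySpace p) := inferInstanceAs (Module ℂ (clamped p × L2 p.L × ℂ))

/-- The first component. -/
def u (w : EnergySpace p) : L2 p.L := (w.1 : L2 p.L)

/-- The second component. -/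
def v (w : EnergySpace p) : L2 p.L := w.2.1

/-- The third component. -/
def ξ (w : EnergySpace p) : ℂ := w.2.2

/-- The triple `[u, v, ξ]`. -/
def mk (u : L2 p.L) (hu : u ∈ clamped p) (v : L2 p.L) (ξ : ℂ) : EnergySpace p := (⟨u, hu⟩, v, ξ)

theorem u_mem (w : EnergySpace p) : w.u ∈ clamped p := w.1.2

theorem ext_iff_comp {w z : EnergySpace p} (hu : w.u = z.u) (hv : w.v = z.v) (hξ : w.ξ = z.ξ) :
    w = z :=
  Prod.ext (Subtype.ext hu) (Prod.ext hv hξ)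

theorem u_add (w z : EnergySpace p) : (w + z).u = w.u + z.u := rfl

theorem v_add (w z : EnergySpace p) : (w + z).v = w.v + z.v := rfl

theorem ξ_add (w z : EnergySpace p) : (w + z).ξ = w.ξ + z.ξ := rfl

theorem u_smul (c : ℂ) (w : EnergySpace p) : (c • w).u = c • w.u := rfl

theorem v_smul (c : ℂ) (w : EnergySpace p) : (c • w).v = c • w.v := rfl

theorem ξ_smul (c : ℂ) (w : EnergySpace p) : (c • w).ξ = c * w.ξ := rfl

theorem u_zero : (0 : EnergySpace p).u = 0 := rfl

theorem v_zero : (0 : EnergySpace p).v = 0 := rfl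

theorem ξ_zero : (0 : EnergySpace p).ξ = 0 := rfl

/-- The energy inner product
`⟪w₁, w₂⟫ = Λ/2 ∫ u₁'' conj(u₂'') + ρ/2 ∫ v₁ conj(v₂) + 1/(2J) ξ₁ conj(ξ₂)`.
Following Mathlib's convention for `inner`, the conjugate-linear argument `w₂` comes first. -/
def energyInner (w₂ w₁ : EnergySpace p) : ℂ :=
  (p.Λ / 2 : ℝ) * (∫ x in Ioo 0 p.L, (weakDeriv^[2] w₁.u) x * conj ((weakDeriv^[2] w₂.u) x))
    + (p.ρ / 2 : ℝ) * (∫ x in Ioo 0 p.L, w₁.v x * conj (w₂.v x))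
    + (1 / (2 * p.J) : ℝ) * (w₁.ξ * conj w₂.ξ)

theorem energyInner_eq (w₂ w₁ : EnergySpace p) : energyInner w₂ w₁ =
    (p.Λ / 2 : ℝ) * inner ℂ (weakDeriv^[2] w₂.u) (weakDeriv^[2] w₁.u)
    + (p.ρ / 2 : ℝ) * inner ℂ w₂.v w₁.v
    + (1 / (2 * p.J) : ℝ) * inner ℂ w₂.ξ w₁.ξ := by
  simp only [energyInner, L2.inner_def, RCLike.inner_apply]

theorem energyInner_self (w : EnergySpace p) : energyInner w w =
    ((p.Λ / 2 * ‖weakDeriv^[2] w.u‖ ^ 2 + p.ρ / 2 * ‖w.v‖ ^ 2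
      + 1 / (2 * p.J) * ‖w.ξ‖ ^ 2 : ℝ) : ℂ) := by
  rw [energyInner_eq, inner_self_eq_norm_sq_to_K, inner_self_eq_norm_sq_to_K,
    inner_self_eq_norm_sq_to_K]
  push_cast
  rfl

/-- The energy inner product is positive definite. -/
@[reducible] def core : InnerProductSpace.Core ℂ (EnergySpace p) where
  inner := energyInner
  conj_inner_symm x y := by
    simp only [energyInner_eq, map_add, map_mul, Complex.conj_ofReal, inner_conj_symm]
  re_inner_nonneg x := by
    have h1 := p.Λ_pos
    have h2 := p.ρ_pos
    have h3 := p.J_pos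
    show 0 ≤ RCLike.re (energyInner x x)
    rw [energyInner_self]
    rw [RCLike.re_eq_complex_re, Complex.ofReal_re]
    positivity
  add_left x y z := by
    show energyInner _ _ = energyInner _ _ + energyInner _ _
    simp only [energyInner_eq, u_add, v_add, ξ_add, inner_add_left,
      iterate_weakDeriv_add 2 x.u_mem.1 y.u_mem.1]
    ring
  smul_left x y r := by
    show energyInner _ _ = _ * energyInner _ _
    simp only [energyInner_eq, u_smul, v_smul, ξ_smul, inner_smul_left,
      iterate_weakDeriv_smul 2 r x.u_mem.1]
    rw [← smul_eq_mul r x.ξ, inner_smul_left]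
    ring
  definite x hx := by
    have h1 := p.Λ_pos
    have h2 := p.ρ_pos
    have h3 := p.J_pos
    change energyInner x x = 0 at hx
    rw [energyInner_self, Complex.ofReal_eq_zero] at hx
    have a1 : 0 ≤ p.Λ / 2 * ‖weakDeriv^[2] x.u‖ ^ 2 := by positivity
    have a2 : 0 ≤ p.ρ / 2 * ‖x.v‖ ^ 2 := by positivity
    have a3 : 0 ≤ 1 / (2 * p.J) * ‖x.ξ‖ ^ 2 := by positivity
    have b1 : p.Λ / 2 * ‖weakDeriv^[2] x.u‖ ^ 2 = 0 := by linarith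
    have b2 : p.ρ / 2 * ‖x.v‖ ^ 2 = 0 := by linarith
    have b3 : 1 / (2 * p.J) * ‖x.ξ‖ ^ 2 = 0 := by linarith
    have e : ∀ {r s : ℝ}, 0 < r → r * s ^ 2 = 0 → s = 0 := fun hr h =>
      pow_eq_zero_iff (two_ne_zero) |>.1 ((mul_eq_zero.1 h).resolve_left hr.ne')
    refine ext_iff_comp ?_ ?_ ?_
    · exact eq_zero_of_clamped x.u_mem (norm_eq_zero.1 (e (by positivity) b1))
    · exact norm_eq_zero.1 (e (by positivity) b2)
    · exact norm_eq_zero.1 (e (by positivity) b3)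

instance : NormedAddCommGroup (EnergySpace p) := core.toNormedAddCommGroup

instance : InnerProductSpace ℂ (EnergySpace p) := InnerProductSpace.ofCore core.toCore

theorem inner_eq (w₂ w₁ : EnergySpace p) : inner ℂ w₂ w₁ = energyInner w₂ w₁ := rfl

theorem norm_sq_eq (w : EnergySpace p) : ‖w‖ ^ 2 =
    p.Λ / 2 * ‖weakDeriv^[2] w.u‖ ^ 2 + p.ρ / 2 * ‖w.v‖ ^ 2 + 1 / (2 * p.J) * ‖w.ξ‖ ^ 2 := by
  have h := inner_self_eq_norm_sq_to_K (𝕜 := ℂ) w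
  rw [inner_eq, energyInner_self] at h
  exact Complex.ofReal_injective (by rw [h]; push_cast; rfl)

/-- The isometry `[u, v, ξ] ↦ (√(Λ/2) u'', √(ρ/2) v, √(1/(2J)) ξ)`, used to show that the energy
space is complete. -/
def toL2 : EnergySpace p →+ WithLp 2 (L2 p.L × WithLp 2 (L2 p.L × ℂ)) where
  toFun w := WithLp.toLp 2 (((√(p.Λ / 2) : ℝ) : ℂ) • weakDeriv^[2] w.u,
    WithLp.toLp 2 (((√(p.ρ / 2) : ℝ) : ℂ) • w.v, ((√(1 / (2 * p.J)) : ℝ) : ℂ) • w.ξ))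
  map_zero' := by
    simp only [u_zero, v_zero, ξ_zero, iterate_weakDeriv_zero, smul_zero]
    rfl
  map_add' w z := by
    simp only [u_add, v_add, ξ_add, smul_add, iterate_weakDeriv_add 2 w.u_mem.1 z.u_mem.1]
    rfl

theorem norm_toL2 (w : EnergySpace p) : ‖toL2 w‖ = ‖w‖ := by
  have h1 := p.Λ_pos
  have h2 := p.ρ_pos
  have h3 := p.J_pos
  rw [← sq_eq_sq₀ (norm_nonneg _) (norm_nonneg _), norm_sq_eq, WithLp.prod_norm_sq_eq_of_L2]
  simp only [toL2, AddMonoidHom.coe_mk, ZeroHom.coe_mk]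
  have h4 := WithLp.prod_norm_sq_eq_of_L2 (WithLp.toLp 2 (((√(p.ρ / 2) : ℝ) : ℂ) • w.v,
    ((√(1 / (2 * p.J)) : ℝ) : ℂ) • w.ξ))
  show ‖((√(p.Λ / 2) : ℝ) : ℂ) • weakDeriv^[2] w.u‖ ^ 2 + ‖WithLp.toLp 2
    (((√(p.ρ / 2) : ℝ) : ℂ) • w.v, ((√(1 / (2 * p.J)) : ℝ) : ℂ) • w.ξ)‖ ^ 2 = _
  rw [h4]
  show _ + (‖((√(p.ρ / 2) : ℝ) : ℂ) • w.v‖ ^ 2 + ‖((√(1 / (2 * p.J)) : ℝ) : ℂ) • w.ξ‖ ^ 2) = _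
  simp only [norm_smul, mul_pow, Complex.norm_real, Real.norm_eq_abs, sq_abs]
  rw [Real.sq_sqrt (by positivity), Real.sq_sqrt (by positivity), Real.sq_sqrt (by positivity)]
  ring

theorem toL2_surjective : Function.Surjective (toL2 (p := p)) := by
  have h1 := p.Λ_pos
  have h2 := p.ρ_pos
  have h3 := p.J_pos
  have e : ∀ {r : ℝ}, 0 < r → ((√r : ℝ) : ℂ) ≠ 0 := fun hr =>
    Complex.ofReal_ne_zero.2 (Real.sqrt_ne_zero'.2 hr)
  intro y
  obtain ⟨f, hf, hfg⟩ := exists_clamped p (((√(p.Λ / 2) : ℝ) : ℂ)⁻¹ • y.fst)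
  refine ⟨mk f hf (((√(p.ρ / 2) : ℝ) : ℂ)⁻¹ • y.snd.fst)
    (((√(1 / (2 * p.J)) : ℝ) : ℂ)⁻¹ • y.snd.snd), ?_⟩
  show WithLp.toLp 2 (((√(p.Λ / 2) : ℝ) : ℂ) • weakDeriv^[2] f,
    WithLp.toLp 2 (((√(p.ρ / 2) : ℝ) : ℂ) • (((√(p.ρ / 2) : ℝ) : ℂ)⁻¹ • y.snd.fst),
      ((√(1 / (2 * p.J)) : ℝ) : ℂ) • (((√(1 / (2 * p.J)) : ℝ) : ℂ)⁻¹ • y.snd.snd))) = y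
  rw [hfg, smul_inv_smul₀ (e (by positivity)), smul_inv_smul₀ (e (by positivity)),
    smul_inv_smul₀ (e (by positivity))]
  rfl

instance : CompleteSpace (EnergySpace p) :=
  ((AddMonoidHomClass.isometry_of_norm toL2 norm_toL2).isUniformInducing.completeSpace_congr
    toL2_surjective).2 inferInstance

end EnergySpace

/-- The domain `{u ∈ H̃⁴₀(0, L), v ∈ H̃²₀(0, L), ξ = J v'(L), u'''(L) = 0}` of the beam operator. -/
def beamDomain (p : BeamParams) : Submodule ℂ (EnergySpace p) where
  carrier := {w | w.u ∈ sobolev p.L 4 ∧ w.v ∈ clamped p ∧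
    w.ξ = p.J * pointValue (weakDeriv w.v) p.L ∧ pointValue (weakDeriv^[3] w.u) p.L = 0}
  add_mem' := by
    rintro w z ⟨hw1, hw2, hw3, hw4⟩ ⟨hz1, hz2, hz3, hz4⟩
    refine ⟨add_mem hw1 hz1, add_mem hw2 hz2, ?_, ?_⟩
    · rw [EnergySpace.ξ_add, EnergySpace.v_add,
        weakDeriv_add (sobolev_succ_le _ 1 hw2.1) (sobolev_succ_le _ 1 hz2.1), pointValue_add
        p.L_pos (weakDeriv_mem hw2.1) (weakDeriv_mem hz2.1) p.L_mem, hw3, hz3, mul_add]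
    · rw [EnergySpace.u_add, iterate_weakDeriv_add 3 (sobolev_succ_le _ 3 hw1)
        (sobolev_succ_le _ 3 hz1), pointValue_add p.L_pos (iterate_weakDeriv_mem 1 3 hw1)
        (iterate_weakDeriv_mem 1 3 hz1) p.L_mem, hw4, hz4, add_zero]
  zero_mem' := by
    refine ⟨zero_mem _, zero_mem _, ?_, ?_⟩
    · rw [EnergySpace.ξ_zero, EnergySpace.v_zero, IsWeakDeriv.zero.weakDeriv_eq,
        pointValue_zero p.L_pos p.L_mem, mul_zero]
    · rw [EnergySpace.u_zero, iterate_weakDeriv_zero, pointValue_zero p.L_pos p.L_mem]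
  smul_mem' := by
    rintro c w ⟨hw1, hw2, hw3, hw4⟩
    refine ⟨Submodule.smul_mem _ c hw1, Submodule.smul_mem _ c hw2, ?_, ?_⟩
    · rw [EnergySpace.ξ_smul, EnergySpace.v_smul, weakDeriv_smul c (sobolev_succ_le _ 1 hw2.1),
        pointValue_smul p.L_pos c (weakDeriv_mem hw2.1) p.L_mem, hw3, mul_left_comm]
    · rw [EnergySpace.u_smul, iterate_weakDeriv_smul 3 c (sobolev_succ_le _ 3 hw1),
        pointValue_smul p.L_pos c (iterate_weakDeriv_mem 1 3 hw1) p.L_mem, hw4, mul_zero]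

theorem mk_add {p : BeamParams} {u u' v v' : L2 p.L} (hu : u ∈ clamped p) (hu' : u' ∈ clamped p)
    {ξ ξ' : ℂ} : EnergySpace.mk (u + u') (add_mem hu hu') (v + v') (ξ + ξ') =
      EnergySpace.mk u hu v ξ + EnergySpace.mk u' hu' v' ξ' := rfl

theorem mk_smul {p : BeamParams} {u v : L2 p.L} (hu : u ∈ clamped p) (c : ℂ)
    {ξ : ℂ} : EnergySpace.mk (c • u) (Submodule.smul_mem _ c hu) (c • v) (c * ξ) =
      c • EnergySpace.mk u hu v ξ := rfl

theorem mk_congr {p : BeamParams} {u v v' : L2 p.L} {hu hu' : u ∈ clamped p}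
    {ξ ξ' : ℂ} (hv : v = v') (hξ : ξ = ξ') :
    EnergySpace.mk u hu v ξ = EnergySpace.mk u hu' v' ξ' := by rw [hv, hξ]

/-- The operator `[u, v, ξ] ↦ [v, -(Λ/ρ) u'''', -Λ u''(L)]` in the energy space, with domain
`beamDomain p`. -/
def beamOperator (p : BeamParams) : EnergySpace p →ₗ.[ℂ] EnergySpace p where
  domain := beamDomain p
  toFun :=
    { toFun := fun w => EnergySpace.mk w.1.v w.2.2.1 (-(p.Λ / p.ρ : ℂ) • weakDeriv^[4] w.1.u)
        (-(p.Λ : ℂ) * pointValue (weakDeriv^[2] w.1.u) p.L)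
      map_add' := by
        rintro ⟨w, hw⟩ ⟨z, hz⟩
        refine (mk_congr ?_ ?_).trans (mk_add hw.2.1 hz.2.1)
        · rw [← smul_add, ← iterate_weakDeriv_add 4 hw.1 hz.1]
          exact rfl
        · rw [← mul_add, ← pointValue_add p.L_pos
            (iterate_weakDeriv_mem 1 2 (sobolev_succ_le _ 3 hw.1))
            (iterate_weakDeriv_mem 1 2 (sobolev_succ_le _ 3 hz.1)) p.L_mem,
            ← iterate_weakDeriv_add 2 w.u_mem.1 z.u_mem.1]
          exact rfl
      map_smul' := by
        rintro c ⟨w, hw⟩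
        refine (mk_congr ?_ ?_).trans (mk_smul hw.2.1 c)
        · rw [smul_comm, ← iterate_weakDeriv_smul 4 c hw.1]
          exact rfl
        · rw [mul_left_comm, ← pointValue_smul p.L_pos c
            (iterate_weakDeriv_mem 1 2 (sobolev_succ_le _ 3 hw.1)) p.L_mem,
            ← iterate_weakDeriv_smul 2 c w.u_mem.1]
          exact rfl }

section Spectral

variable {E : Type*} [NormedAddCommGroup E] [InnerProductSpace ℂ E]

/-- A densely defined operator `A` is skew-adjoint if its Hilbert space adjoint is `-A`
(with equality of domains). -/
def IsSkewAdjointOperator [CompleteSpace E] (A : E →ₗ.[ℂ] E) : Prop :=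
  Dense (A.domain : Set E) ∧ A.adjoint = -A

/-- The bounded operator `R` is the resolvent `(z - A)⁻¹`. -/
def IsResolventAt (A : E →ₗ.[ℂ] E) (z : ℂ) (R : E →L[ℂ] E) : Prop :=
  (∀ y : E, ∃ h : R y ∈ A.domain, z • R y - A ⟨R y, h⟩ = y) ∧
    ∀ x : A.domain, R (z • (x : E) - A x) = x

/-- The resolvent set of an unbounded operator. -/
def operatorResolventSet (A : E →ₗ.[ℂ] E) : Set ℂ := {z | ∃ R, IsResolventAt A z R}

/-- The spectrum of an unbounded operator. -/
def operatorSpectrum (A : E →ₗ.[ℂ] E) : Set ℂ := (operatorResolventSet A)ᶜ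

/-- The resolvent set is nonempty and all resolvents are compact. -/
def HasCompactResolvent (A : E →ₗ.[ℂ] E) : Prop :=
  (operatorResolventSet A).Nonempty ∧
    ∀ (z : ℂ) (R : E →L[ℂ] E), IsResolventAt A z R → IsCompactOperator R

/-- The eigenspace `ker (A - z)` of an unbounded operator. -/
def operatorEigenspace (A : E →ₗ.[ℂ] E) (z : ℂ) : Submodule ℂ E where
  carrier := {x | ∃ h : x ∈ A.domain, A ⟨x, h⟩ = z • x}
  add_mem' := by
    rintro x y ⟨hx, hx'⟩ ⟨hy, hy'⟩
    refine ⟨add_mem hx hy, ?_⟩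
    rw [smul_add, ← hx', ← hy', ← A.map_add]
    rfl
  zero_mem' := ⟨zero_mem _, by
    rw [smul_zero]
    exact A.map_zero⟩
  smul_mem' := by
    rintro c x ⟨hx, hx'⟩
    refine ⟨Submodule.smul_mem _ c hx, ?_⟩
    rw [smul_comm, ← hx', ← A.map_smul]
    rfl

end Spectral

/-- `f ∈ H̃⁴₀(0, L)` solves the boundary value problem
`ρ μ² f + Λ f'''' = 0`, `f'''(L) = 0`, `J μ² f'(L) + Λ f''(L) = 0`. -/
def SolvesEigenBVP (p : BeamParams) (μ : ℂ) (f : L2 p.L) : Prop :=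
  f ∈ clamped p ∧ f ∈ sobolev p.L 4 ∧
    (p.ρ * μ ^ 2 : ℂ) • f + (p.Λ : ℂ) • weakDeriv^[4] f = 0 ∧
    pointValue (weakDeriv^[3] f) p.L = 0 ∧
    p.J * μ ^ 2 * pointValue (weakDeriv f) p.L + p.Λ * pointValue (weakDeriv^[2] f) p.L = 0

/-- `f` is a real-valued function. -/
def IsRealValued {L : ℝ} (f : L2 L) : Prop := ∀ᵐ x ∂(volume.restrict (Ioo 0 L)), (f x).im = 0

/-- The triple `[f, μ f, μ J f'(L)]`. -/
def eigenTriple (p : BeamParams) (μ : ℂ) (f : clamped p) : EnergySpace p :=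
  EnergySpace.mk (f : L2 p.L) f.2 (μ • (f : L2 p.L))
    (μ * p.J * pointValue (weakDeriv (f : L2 p.L)) p.L)

end EulerBernoulli

end

/-! The operator `beamOperator p` is skew-symmetric and has an explicit compact two-sided inverse;
nearly everything except simplicity and the real form of the eigenfunctions follows from these two
facts.

Skew-symmetry is Green's formula (`inner_second_weakDeriv`): integrating $\int v''\overline{u''}$ by
parts twice leaves only the boundary term with $v'(L)$ and $u''(L)$, and the relation $\xi=Jv'(L)$
makes the $\xi$-part of the inner product cancel it. For the inverse, $u''''$ is integrated twice
from $L$, where $u'''(L)=0$ and $u''(L)$ are prescribed, and $u''$ twice from the clamped end $0$.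
In the coordinates $(u'',v,\xi)$ this is built from Volterra operators and finite-rank maps, so
`beamInverse` is compact.

A skew-symmetric operator with a bounded two-sided inverse $R$ is densely defined and skew-adjoint.
If $R$ is compact, the resolvent is compact, the spectrum consists of imaginary eigenvalues with
finitely many in each disc, and the spectral theorem for the compact self-adjoint operator $iR$
shows that the eigenvectors are total.

Simplicity is a statement about the differential equation. For an eigenvalue, $f''''=\beta^4f$ with
$\beta>0$, and a clamped solution with $f'''(L)=0$ is determined by $f''(0)$. For each fourth root
$\kappa$ of $\beta^4$, the combination $f'''+\kappa f''+\kappa^2f'+\kappa^3f$ is a multiple of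
$e^{\kappa x}$. If $f''(0)=0$, summing over the four roots at $x=L$ gives $(\cosh\beta L+\cos\beta
L)f'''(0)=0$, so $f'''(0)=0$ and then $f=0$.

The boundary value problem involves only $\mu^2$, which is real. Hence conjugation preserves
solutions, which gives real eigenfunctions, and $\mu$ and $-\mu$ share them. The spectrum is
infinite because finitely many finite-dimensional eigenspaces would fill the space and lie in the
domain, which is a proper subspace. -/

noncomputable section

namespace EulerBernoulli

/-! ### Abstract spectral theory: skew-symmetric operators with compact inverse -/

section SkewWithCompactInverse

variable {E : Type*} [NormedAddCommGroup E] [InnerProductSpace ℂ E]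

/-- The bounded operator `R` is a two-sided inverse of the unbounded operator `A`. -/
def IsInverseOf (A : E →ₗ.[ℂ] E) (R : E →L[ℂ] E) : Prop :=
  (∀ y, ∃ h : R y ∈ A.domain, A ⟨R y, h⟩ = y) ∧ ∀ x : A.domain, R (A x) = x

/-- The operator `A` is skew-symmetric on its domain. -/
def IsSkewSymmetric (A : E →ₗ.[ℂ] E) : Prop :=
  ∀ x y : A.domain, inner ℂ (A x) (y : E) = -inner ℂ (x : E) (A y)

variable {A : E →ₗ.[ℂ] E} {R : E →L[ℂ] E}

theorem IsInverseOf.mem_domain (hR : IsInverseOf A R) (y : E) : R y ∈ A.domain := (hR.1 y).1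

theorem IsInverseOf.apply_inverse (hR : IsInverseOf A R) (y : E) (h : R y ∈ A.domain) :
    A ⟨R y, h⟩ = y := (hR.1 y).2

theorem IsInverseOf.eq_zero (hR : IsInverseOf A R) {y : E} (hy : R y = 0) : y = 0 := by
  obtain ⟨h, e⟩ := hR.1 y
  rw [← e]
  have : (⟨R y, h⟩ : A.domain) = 0 := Subtype.ext hy
  rw [this]
  exact A.map_zero

theorem IsSkewSymmetric.inner_inverse (hA : IsSkewSymmetric A) (hR : IsInverseOf A R) (x y : E) :
    inner ℂ (R x) y = -inner ℂ x (R y) := by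
  have := hA ⟨R x, hR.mem_domain x⟩ ⟨R y, hR.mem_domain y⟩
  rw [hR.apply_inverse, hR.apply_inverse] at this
  rw [this, neg_neg]

/-- The range of $R$ lies in the domain. If $y$ is orthogonal to it, then $\langle
x,Ry\rangle=-\langle Rx,y\rangle=0$ for all $x$, so $Ry=0$ and $y=0$. -/
theorem IsSkewSymmetric.dense_domain [CompleteSpace E] (hA : IsSkewSymmetric A)
    (hR : IsInverseOf A R) : Dense (A.domain : Set E) := by
  rw [Submodule.dense_iff_topologicalClosure_eq_top, ← Submodule.orthogonal_orthogonal_eq_closure,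
    Submodule.orthogonal_eq_top_iff, Submodule.eq_bot_iff]
  intro y hy
  refine hR.eq_zero (ext_inner_left ℂ fun x => ?_)
  have h := hA.inner_inverse hR x y
  rw [(Submodule.mem_orthogonal _ _).1 hy _ (hR.mem_domain x)] at h
  rw [inner_zero_right, ← neg_eq_zero, h]

/-- Skew-symmetry gives $-A\subseteq A^*$. The reverse inclusion uses surjectivity of $A$: the
identity $RA^*y=-y$ puts every $y$ in the domain of $A^*$ into the range of $R$, hence into the
domain of $A$. -/
theorem IsSkewSymmetric.isSkewAdjointOperator [CompleteSpace E] (hA : IsSkewSymmetric A)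
    (hR : IsInverseOf A R) : IsSkewAdjointOperator A := by
  have hd := hA.dense_domain hR
  refine ⟨hd, le_antisymm ?_ ?_⟩
  · have key : ∀ y : A.adjoint.domain, R (A.adjoint y) = -(y : E) := by
      intro y
      refine ext_inner_right ℂ fun z => ?_
      have := A.adjoint_isFormalAdjoint hd y ⟨R z, hR.mem_domain z⟩
      rw [hR.apply_inverse] at this
      rw [hA.inner_inverse hR, inner_neg_left, ← this]
    refine ⟨fun y hy => ?_, ?_⟩
    · have h1 := hR.mem_domain (A.adjoint ⟨y, hy⟩)
      rw [key ⟨y, hy⟩] at h1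
      simpa using h1
    · rintro ⟨y, hy⟩ ⟨z, hz⟩ (rfl : y = z)
      have h1 := hR.mem_domain (A.adjoint ⟨y, hy⟩)
      have h2 := hR.apply_inverse (A.adjoint ⟨y, hy⟩) h1
      rw [← h2, LinearPMap.neg_apply, ← LinearPMap.map_neg]
      congr 1
      exact Subtype.ext (key ⟨y, hy⟩)
  · refine LinearPMap.IsFormalAdjoint.le_adjoint hd fun x y => ?_
    rw [LinearPMap.neg_apply, inner_neg_right, ← hA x y]

theorem IsInverseOf.isResolventAt_zero (hR : IsInverseOf A R) : IsResolventAt A 0 (-R) := by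
  refine ⟨fun y => ⟨A.domain.neg_mem (hR.mem_domain y), ?_⟩, fun x => ?_⟩
  · have : (⟨(-R) y, A.domain.neg_mem (hR.mem_domain y)⟩ : A.domain)
        = -⟨R y, hR.mem_domain y⟩ := rfl
    rw [this, LinearPMap.map_neg, hR.apply_inverse, zero_smul, zero_sub, neg_neg]
  · rw [zero_smul, zero_sub, neg_apply, map_neg, neg_neg, hR.2]

theorem IsInverseOf.hasCompactResolvent (hR : IsInverseOf A R) (hc : IsCompactOperator R) :
    HasCompactResolvent A := by
  refine ⟨⟨0, -R, hR.isResolventAt_zero⟩, fun z S hS => ?_⟩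
  -- The resolvent equation says $AS=zS-1$; applying $R$ displays $S$ as a compact operator composed
  -- with a bounded one.
  have : S = R ∘L (z • S - ContinuousLinearMap.id ℂ E) := by
    ext y
    obtain ⟨h, e⟩ := hS.1 y
    have : z • S y - y = A ⟨S y, h⟩ := by
      nth_rewrite 2 [← e]
      abel
    show S y = R (z • S y - y)
    rw [this, hR.2]
  rw [this]
  exact hc.comp_clm _

theorem operatorEigenspace_eq_bot_of_mem_resolventSet {z : ℂ} (hz : z ∈ operatorResolventSet A) :
    operatorEigenspace A z = ⊥ := by
  obtain ⟨S, hS⟩ := hz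
  refine (Submodule.eq_bot_iff _).2 fun x ⟨hx, e⟩ => ?_
  have := hS.2 ⟨x, hx⟩
  rw [e, sub_self, map_zero] at this
  exact this.symm

theorem IsInverseOf.mem_operatorEigenspace (hR : IsInverseOf A R) {z : ℂ} {x : E}
    (h : x = z • R x) : x ∈ operatorEigenspace A z := by
  have hx : x ∈ A.domain := h ▸ A.domain.smul_mem z (hR.mem_domain x)
  refine ⟨hx, ?_⟩
  have : (⟨x, hx⟩ : A.domain) = z • ⟨R x, hR.mem_domain x⟩ := Subtype.ext h
  rw [this, LinearPMap.map_smul, hR.apply_inverse]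

theorem IsInverseOf.inverse_apply_of_mem (hR : IsInverseOf A R) {z : ℂ} {x : E}
    (h : x ∈ operatorEigenspace A z) : x = z • R x := by
  obtain ⟨hx, e⟩ := h
  have := hR.2 ⟨x, hx⟩
  rw [e, map_smul] at this
  exact this.symm

/-- Fredholm alternative for $R$ at $z^{-1}$: either $z^{-1}$ is an eigenvalue of $R$, and then $z$
is one of $A$, or $z^{-1}-R$ is invertible, and then $z-A$ is. -/
theorem IsInverseOf.mem_operatorSpectrum_iff [CompleteSpace E] (hR : IsInverseOf A R)
    (hc : IsCompactOperator R) {z : ℂ} :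
    z ∈ operatorSpectrum A ↔ operatorEigenspace A z ≠ ⊥ := by
  refine ⟨fun hz h => hz ?_, fun h hz => h (operatorEigenspace_eq_bot_of_mem_resolventSet hz)⟩
  rcases eq_or_ne z 0 with rfl | hz0
  · exact ⟨-R, hR.isResolventAt_zero⟩
  rcases hc.hasEigenvalue_or_mem_resolventSet (inv_ne_zero hz0) with he | hu
  · exfalso
    obtain ⟨x, hx, hx0⟩ := he.exists_hasEigenvector
    refine hx0 ((Submodule.eq_bot_iff _).1 h x (hR.mem_operatorEigenspace ?_))
    have : R x = z⁻¹ • x := Module.End.mem_eigenspace_iff.1 hx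
    rw [this, smul_inv_smul₀ hz0]
  · obtain ⟨U, hU⟩ := hu
    have h1 : ∀ y, z⁻¹ • (U⁻¹.1 y) - R (U⁻¹.1 y) = y := fun y => by
      have := congrArg (fun T : E →L[ℂ] E => T y) U.mul_inv
      rw [hU] at this
      simpa [Algebra.algebraMap_eq_smul_one] using this
    have h2 : ∀ y, U⁻¹.1 (z⁻¹ • y - R y) = y := fun y => by
      have := congrArg (fun T : E →L[ℂ] E => T y) U.inv_mul
      rw [hU] at this
      simpa [Algebra.algebraMap_eq_smul_one] using this
    -- Formally $z-A=-z(z^{-1}-R)A$, so the resolvent is $-z^{-1}R(z^{-1}-R)^{-1}$.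
    refine ⟨(-z⁻¹) • (R ∘L U⁻¹.1), fun y => ?_, fun x => ?_⟩
    · have hm := A.domain.smul_mem (-z⁻¹) (hR.mem_domain (U⁻¹.1 y))
      refine ⟨hm, ?_⟩
      have : (⟨((-z⁻¹) • (R ∘L U⁻¹.1)) y, hm⟩ : A.domain)
          = (-z⁻¹) • ⟨R (U⁻¹.1 y), hR.mem_domain _⟩ := rfl
      rw [this, LinearPMap.map_smul, hR.apply_inverse]
      show z • (-z⁻¹) • R (U⁻¹.1 y) - _ = y
      conv_rhs => rw [← h1 y]
      rw [neg_smul, smul_neg, smul_inv_smul₀ hz0, neg_smul]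
      abel
    · have e : z • (x : E) - A x = (-z) • (z⁻¹ • A x - R (A x)) := by
        rw [hR.2, smul_sub, neg_smul, neg_smul, smul_inv_smul₀ hz0]
        abel
      rw [e]
      show (-z⁻¹) • R (U⁻¹.1 _) = _
      rw [map_smul, h2, map_smul, smul_smul, hR.2]
      simp [hz0]

theorem IsInverseOf.ne_zero_of_eigenspace_ne_bot (hR : IsInverseOf A R) {z : ℂ}
    (hz : operatorEigenspace A z ≠ ⊥) : z ≠ 0 := by
  rintro rfl
  exact hz (operatorEigenspace_eq_bot_of_mem_resolventSet ⟨-R, hR.isResolventAt_zero⟩)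

theorem IsSkewSymmetric.inner_eigenvectors (hA : IsSkewSymmetric A) {z w : ℂ} {x y : E}
    (hx : x ∈ operatorEigenspace A z) (hy : y ∈ operatorEigenspace A w) :
    (conj z + w) * inner ℂ x y = 0 := by
  obtain ⟨hx, ex⟩ := hx
  obtain ⟨hy, ey⟩ := hy
  have := hA ⟨x, hx⟩ ⟨y, hy⟩
  rw [ex, ey, inner_smul_left, inner_smul_right] at this
  linear_combination this

theorem IsSkewSymmetric.re_eigenvalue (hA : IsSkewSymmetric A) {z : ℂ}
    (hz : operatorEigenspace A z ≠ ⊥) : z.re = 0 := by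
  obtain ⟨x, hx, hx0⟩ := (Submodule.ne_bot_iff _).1 hz
  have h1 := (mul_eq_zero.1 (hA.inner_eigenvectors hx hx)).resolve_right
    (inner_self_ne_zero.2 hx0)
  have := congrArg Complex.re h1
  simp at this
  linarith

theorem conj_eq_neg_of_re_eq_zero {z : ℂ} (hz : z.re = 0) : conj z = -z :=
  Complex.ext (by simp [hz]) (by simp)

theorem IsSkewSymmetric.inner_eq_zero (hA : IsSkewSymmetric A) {z w : ℂ} (hzw : z ≠ w) {x y : E}
    (hx : x ∈ operatorEigenspace A z) (hy : y ∈ operatorEigenspace A w) : inner ℂ x y = 0 := by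
  rcases eq_or_ne x 0 with rfl | hx0
  · exact inner_zero_left _
  have hz := conj_eq_neg_of_re_eq_zero (hA.re_eigenvalue ((Submodule.ne_bot_iff _).2 ⟨x, hx, hx0⟩))
  refine (mul_eq_zero.1 (hA.inner_eigenvectors hx hy)).resolve_left fun h => hzw ?_
  rw [hz] at h
  linear_combination -h

/-- Unit eigenvectors $e_n$ for infinitely many distinct eigenvalues $z_n$ in the disc would give
images $Re_n=z_n^{-1}e_n$ that are pairwise orthogonal and of norm at least $1/M$. Such a sequence
has no convergent subsequence, contrary to the compactness of $R$. -/
theorem IsSkewSymmetric.finite_eigenvalues (hA : IsSkewSymmetric A) (hR : IsInverseOf A R)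
    (hc : IsCompactOperator R) (M : ℝ) :
    {z : ℂ | operatorEigenspace A z ≠ ⊥ ∧ ‖z‖ ≤ M}.Finite := by
  by_contra hinf
  let f := Set.Infinite.natEmbedding _ hinf
  have hex : ∀ n, ∃ x ∈ operatorEigenspace A (f n), ‖x‖ = 1 := by
    intro n
    obtain ⟨x, hx, hx0⟩ := (Submodule.ne_bot_iff _).1 (f n).2.1
    exact ⟨((‖x‖⁻¹ : ℝ) : ℂ) • x, Submodule.smul_mem _ _ hx, by
      rw [norm_smul, Complex.norm_real, norm_inv, norm_norm, inv_mul_cancel₀ (norm_ne_zero_iff.2 hx0)]⟩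
  choose e he he1 using hex
  obtain ⟨K, hK, hK'⟩ := hc.image_closedBall_subset_compact (f := R.toLinearMap) 1
  obtain ⟨y, -, ψ, hψ, hy⟩ := hK.tendsto_subseq (x := fun n => R (e n))
    (fun n => hK' ⟨e n, by simp [he1], rfl⟩)
  have hM : 0 < M := (norm_pos_iff.2 (hR.ne_zero_of_eigenspace_ne_bot (f 0).2.1)).trans_le (f 0).2.2
  have hRe : ∀ n, M⁻¹ ≤ ‖R (e n)‖ := by
    intro n
    have h1 := congrArg norm (hR.inverse_apply_of_mem (he n))
    rw [norm_smul, he1] at h1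
    have := mul_le_mul_of_nonneg_right (f n).2.2 (norm_nonneg (R (e n)))
    rw [inv_le_iff_one_le_mul₀ hM]
    linarith
  have hRm : ∀ n, R (e n) ∈ operatorEigenspace A (f n) := fun n => by
    have h1 := hR.inverse_apply_of_mem (he n)
    have h0 := hR.ne_zero_of_eigenspace_ne_bot (f n).2.1
    have : R (e n) = (f n : ℂ)⁻¹ • e n := by
      rw [eq_inv_smul_iff₀ h0]
      exact h1.symm
    rw [this]
    exact Submodule.smul_mem _ _ (he n)
  have hsep : ∀ m n, m ≠ n → M⁻¹ ≤ dist (R (e m)) (R (e n)) := by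
    intro m n hmn
    have ho := hA.inner_eq_zero (fun h => hmn (f.injective (Subtype.ext h))) (hRm m) (hRm n)
    have h2 := @norm_sub_sq ℂ E _ _ _ (R (e m)) (R (e n))
    rw [ho] at h2
    rw [dist_eq_norm]
    -- By orthogonality $\|a-b\|^2=\|a\|^2+\|b\|^2\ge\|a\|^2$.
    refine (hRe m).trans (le_of_sq_le_sq ?_ (norm_nonneg _))
    rw [h2]
    simp
  have hcau := hy.cauchySeq
  obtain ⟨N, hN⟩ := Metric.cauchySeq_iff'.1 hcau M⁻¹ (by positivity)
  exact absurd (hN (N + 1) (by omega)) (not_lt.2 (hsep _ _ (hψ.injective.ne (by omega))))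

/-- Since $R$ is skew-symmetric, $iR$ is compact and self-adjoint, so its eigenvectors are total.
Its kernel is trivial, and every other eigenspace lies in an eigenspace of $A$. -/
theorem IsSkewSymmetric.orthogonal_iSup_eigenspaces [CompleteSpace E] (hA : IsSkewSymmetric A)
    (hR : IsInverseOf A R) (hc : IsCompactOperator R) :
    (⨆ z, operatorEigenspace A z)ᗮ = ⊥ := by
  have hsymm : (Complex.I • R).IsSymmetric := by
    intro x y
    show inner ℂ (Complex.I • R x) y = inner ℂ x (Complex.I • R y)
    rw [inner_smul_left, inner_smul_right, hA.inner_inverse hR]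
    simp
  have h := ContinuousLinearMap.orthogonalComplement_iSup_eigenspaces_eq_bot
    (T := Complex.I • R) (hc.smul _) hsymm
  rw [eq_bot_iff, ← h]
  refine Submodule.orthogonal_le (iSup_le fun μ x hx => ?_)
  have hx' : Complex.I • R x = μ • x := Module.End.mem_eigenspace_iff.1 hx
  rcases eq_or_ne μ 0 with rfl | hμ
  · rw [zero_smul, smul_eq_zero] at hx'
    rw [hR.eq_zero (hx'.resolve_left Complex.I_ne_zero)]
    exact Submodule.zero_mem _
  -- From $iRx=\mu x$ one gets $x=(\mu^{-1}i)Rx$, which is the eigenvalue equation of $A$ at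
  -- $\mu^{-1}i$.
  · refine Submodule.mem_iSup_of_mem (μ⁻¹ * Complex.I) (hR.mem_operatorEigenspace ?_)
    rw [mul_smul, hx', inv_smul_smul₀ hμ]

/-- With finite spectrum the span of the eigenspaces is finite-dimensional, hence closed; being
total it is the whole space. But eigenvectors lie in the domain, which would then be everything. -/
theorem IsSkewSymmetric.infinite_operatorSpectrum [CompleteSpace E] (hA : IsSkewSymmetric A)
    (hR : IsInverseOf A R) (hc : IsCompactOperator R) (hdom : A.domain ≠ ⊤)
    (hfin : ∀ z, FiniteDimensional ℂ (operatorEigenspace A z)) :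
    (operatorSpectrum A).Infinite := by
  intro hS
  have : Finite (operatorSpectrum A) := hS
  have hle : ⨆ z, operatorEigenspace A z ≤ ⨆ z : operatorSpectrum A, operatorEigenspace A z := by
    refine iSup_le fun z => ?_
    by_cases hz : z ∈ operatorSpectrum A
    · exact le_iSup (fun z : operatorSpectrum A => operatorEigenspace A z) ⟨z, hz⟩
    · rw [not_not.1 (mt (hR.mem_operatorSpectrum_iff hc).2 hz)]
      exact bot_le
  have hbot := eq_bot_iff.2 ((Submodule.orthogonal_le hle).trans
    (hA.orthogonal_iSup_eigenspaces hR hc).le)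
  rw [Submodule.orthogonal_eq_bot_iff] at hbot
  apply hdom
  rw [eq_top_iff, ← hbot]
  exact iSup_le fun z x hx => hx.1

theorem IsSkewSymmetric.not_accPt_operatorSpectrum [CompleteSpace E] (hA : IsSkewSymmetric A)
    (hR : IsInverseOf A R) (hc : IsCompactOperator R) (z : ℂ) :
    ¬ AccPt z (𝓟 (operatorSpectrum A)) := by
  intro h
  have hfin := hA.finite_eigenvalues hR hc (‖z‖ + 1)
  have h2 : AccPt z (𝓟 {w : ℂ | operatorEigenspace A w ≠ ⊥ ∧ ‖w‖ ≤ ‖z‖ + 1}) := by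
    rw [accPt_iff_frequently] at h ⊢
    have hn : ∀ᶠ w in 𝓝 z, ‖w‖ < ‖z‖ + 1 :=
      continuous_norm.continuousAt.eventually_lt continuousAt_const (by linarith)
    refine (h.and_eventually hn).mono fun w hw => ⟨hw.1.1, ?_, hw.2.le⟩
    exact (hR.mem_operatorSpectrum_iff hc).1 hw.1.2
  exact (Set.Infinite.of_accPt h2) hfin

end SkewWithCompactInverse

/-! ### Integration by parts for absolutely continuous functions -/

section IntegrationByParts

theorem absolutelyContinuousOnInterval_const {F : Type*} [SeminormedAddCommGroup F] (c : F)
    (a b : ℝ) : AbsolutelyContinuousOnInterval (fun _ => c) a b :=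
  (LipschitzWith.const c).lipschitzOnWith.absolutelyContinuousOnInterval

/-- Primitives of complex-valued integrable functions are absolutely continuous. -/
theorem absolutelyContinuousOnInterval_integral {f : ℝ → ℂ} {a b : ℝ}
    (hf : IntervalIntegrable f volume a b) :
    AbsolutelyContinuousOnInterval (fun x => ∫ t in a..x, f t) a b := by
  have hre : IntervalIntegrable (fun t => (f t).re) volume a b := ⟨hf.1.re, hf.2.re⟩
  have him : IntervalIntegrable (fun t => (f t).im) volume a b := ⟨hf.1.im, hf.2.im⟩
  -- Real and imaginary parts are handled as real primitives and recombined with the constants $1$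
  -- and $i$.
  have h1 := (hre.absolutelyContinuousOnInterval_intervalIntegral left_mem_uIcc).smul
    (absolutelyContinuousOnInterval_const (1 : ℂ) a b)
  have h2 := (him.absolutelyContinuousOnInterval_intervalIntegral left_mem_uIcc).smul
    (absolutelyContinuousOnInterval_const Complex.I a b)
  have h3 := h1.add h2
  rw [absolutelyContinuousOnInterval_iff] at h3 ⊢
  intro ε hε
  obtain ⟨δ, hδ, h⟩ := h3 ε hε
  refine ⟨δ, hδ, fun I hI hI' => ?_⟩
  have hval : ∀ x ∈ uIcc a b, (∫ t in a..x, f t) =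
      (∫ t in a..x, (f t).re) • (1 : ℂ) + (∫ t in a..x, (f t).im) • Complex.I := by
    intro x hx
    have hfx : IntervalIntegrable f volume a x := hf.mono_set (uIcc_subset_uIcc_left hx)
    have e1 := intervalIntegral.intervalIntegral_re (𝕜 := ℂ) hfx
    have e2 := intervalIntegral.intervalIntegral_im (𝕜 := ℂ) hfx
    simp only [RCLike.re_eq_complex_re, RCLike.im_eq_complex_im] at e1 e2
    rw [e1, e2]
    apply Complex.ext <;> simp
  refine lt_of_eq_of_lt (Finset.sum_congr rfl fun i hi => ?_) (h I hI hI')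
  rw [hval _ (hI.1 i hi).1, hval _ (hI.1 i hi).2]
  rfl

/-- Integration by parts for primitives of integrable functions. -/
theorem integral_mul_add_mul_of_primitive {f g F G : ℝ → ℂ} {a b : ℝ}
    (hf : IntervalIntegrable f volume a b) (hg : IntervalIntegrable g volume a b)
    (hF : ∀ x ∈ uIcc a b, F x = F a + ∫ t in a..x, f t)
    (hG : ∀ x ∈ uIcc a b, G x = G a + ∫ t in a..x, g t) :
    ∫ x in a..b, (f x * G x + F x * g x) = F b * G b - F a * G a := by
  -- `F` and `G` are primitives only on the interval; `F'` and `G'` are given by the same formula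
  -- everywhere, so they have derivatives at almost every point of it.
  set F' : ℝ → ℂ := fun x => F a + ∫ t in a..x, f t with hF'
  set G' : ℝ → ℂ := fun x => G a + ∫ t in a..x, g t with hG'
  have hFa : AbsolutelyContinuousOnInterval F' a b :=
    (absolutelyContinuousOnInterval_const (F a) a b).add (absolutelyContinuousOnInterval_integral hf)
  have hGa : AbsolutelyContinuousOnInterval G' a b :=
    (absolutelyContinuousOnInterval_const (G a) a b).add (absolutelyContinuousOnInterval_integral hg)
  have hi : IntervalIntegrable (fun x => f x * G' x + F' x * g x) volume a b :=
    (hf.mul_continuousOn hGa.continuousOn).add (hg.continuousOn_mul hFa.continuousOn)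
  -- The function $F'G'-\int_a^x(fG'+F'g)$ is absolutely continuous with derivative zero almost
  -- everywhere, hence constant.
  have hH := (hFa.smul hGa).sub (absolutelyContinuousOnInterval_integral hi)
  obtain ⟨C, hC⟩ := hH.const_of_ae_hasDerivAt_zero (by
    filter_upwards [hf.ae_hasDerivAt_integral, hg.ae_hasDerivAt_integral,
      hi.ae_hasDerivAt_integral] with x h1 h2 h3 hx
    have d1 : HasDerivAt F' (f x) x := (h1 hx a left_mem_uIcc).const_add _
    have d2 : HasDerivAt G' (g x) x := (h2 hx a left_mem_uIcc).const_add _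
    have d := (d1.mul d2).sub (h3 hx a left_mem_uIcc)
    rwa [sub_self] at d)
  have e1 := hC a left_mem_uIcc
  have e2 := hC b right_mem_uIcc
  simp only [Pi.sub_apply, smul_eq_mul, Pi.mul_apply, intervalIntegral.integral_same,
    sub_zero] at e1 e2
  have e3 : F' a = F a := by simp [hF']
  have e4 : G' a = G a := by simp [hG']
  rw [e3, e4] at e1
  rw [hF b right_mem_uIcc, hG b right_mem_uIcc]
  have e5 : ∫ x in a..b, (f x * G x + F x * g x) = ∫ x in a..b, (f x * G' x + F' x * g x) := by
    refine intervalIntegral.integral_congr fun x hx => ?_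
    show f x * G x + F x * g x = f x * G' x + F' x * g x
    rw [hF x hx, hG x hx]
  rw [e5]
  rw [← e1] at e2
  linear_combination -e2

end IntegrationByParts

/-! ### Compactness of integral operators with square integrable kernel -/

section IntegralOperator

variable {α E : Type*} [MeasurableSpace α] {ν : Measure α} [NormedAddCommGroup E] [NormedSpace ℂ E]

/-- The operator `f ↦ (x ↦ k x f)` given by a square integrable functional-valued kernel. -/
def kernelOperator : Lp (E →L[ℂ] ℂ) 2 ν →L[ℂ] E →L[ℂ] Lp ℂ 2 ν :=
  (ContinuousLinearMap.compLpL₂ 2 ν (ContinuousLinearMap.apply ℂ ℂ)).flip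

theorem kernelOperator_apply (k : Lp (E →L[ℂ] ℂ) 2 ν) (f : E) :
    kernelOperator k f =ᵐ[ν] fun x => k x f :=
  ContinuousLinearMap.coeFn_compLp _ _

theorem isCompactOperator_smulRight {F : Type*} [NormedAddCommGroup F] [NormedSpace ℂ F]
    (l : E →L[ℂ] ℂ) (c : F) : IsCompactOperator (l.smulRight c) := by
  have h : IsCompactOperator l := isCompactOperator_of_locallyCompactSpace_dom l
  exact h.clm_comp (ContinuousLinearMap.toSpanSingleton ℂ c)

theorem isClosed_isCompactOperator {F : Type*} [NormedAddCommGroup F] [NormedSpace ℂ F]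
    [CompleteSpace F] : IsClosed {T : E →L[ℂ] F | IsCompactOperator T} :=
  isClosed_setOfPred_isCompactOperator

/-- An operator with a square integrable functional-valued kernel is compact. -/
theorem isCompactOperator_kernelOperator (k : Lp (E →L[ℂ] ℂ) 2 ν) :
    IsCompactOperator (kernelOperator k) := by
  refine Lp.induction (by norm_num) (motive := fun k => IsCompactOperator (kernelOperator k))
    ?_ ?_ ?_ k
  · intro c s hs hμs
    -- A kernel equal to the functional $c$ on $s$ and to zero elsewhere gives the rank-one operator
    -- $f\mapsto c(f)1_s$. Sums and limits of such kernels exhaust the space.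
    have : kernelOperator (ν := ν) (Lp.simpleFunc.indicatorConst 2 hs hμs.ne c)
        = c.smulRight (indicatorConstLp 2 hs hμs.ne (1 : ℂ)) := by
      ext1 f
      apply Lp.ext
      filter_upwards [kernelOperator_apply (ν := ν) (Lp.simpleFunc.indicatorConst 2 hs hμs.ne c) f,
        indicatorConstLp_coeFn (p := 2) (hs := hs) (hμs := hμs.ne) (c := c),
        indicatorConstLp_coeFn (p := 2) (hs := hs) (hμs := hμs.ne) (c := (1 : ℂ)),
        Lp.coeFn_smul (c f) (indicatorConstLp 2 hs hμs.ne (1 : ℂ))] with x h1 h2 h3 h4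
      rw [Lp.simpleFunc.coe_indicatorConst] at h1
      rw [Lp.simpleFunc.coe_indicatorConst, h1, h2, ContinuousLinearMap.smulRight_apply, h4,
        Pi.smul_apply, h3]
      by_cases hx : x ∈ s <;> simp [hx]
    rw [this]
    exact isCompactOperator_smulRight _ _
  · intro f g hf hg _ h1 h2
    rw [map_add]
    exact h1.add h2
  · exact isClosed_isCompactOperator.preimage kernelOperator.continuous

end IntegralOperator

/-! ### The Volterra operator and the fundamental theorem of calculus in $H^1(0,L)$ -/

section Volterra

variable {L : ℝ}

theorem intervalIntegrable_L2 (f : L2 L) {a b : ℝ} (ha : a ∈ Icc 0 L) (hb : b ∈ Icc 0 L) :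
    IntervalIntegrable f volume a b := by
  have h : IntegrableOn f (Icc 0 L) := by
    rw [integrableOn_Icc_iff_integrableOn_Ioo]
    exact integrable_L2 f
  exact (h.mono_set (uIcc_subset_Icc ha hb)).intervalIntegrable

/-- The functional `f ↦ ∫₀ˣ f` on `L²(0, L)`. -/
def integralUpTo (L x : ℝ) : L2 L →L[ℂ] ℂ :=
  innerSL ℂ (indicatorConstLp 2 (measurableSet_Ioo (a := (0 : ℝ)) (b := x))
    (measure_ne_top _ _) (1 : ℂ))

theorem integralUpTo_apply {x : ℝ} (hx : x ∈ Icc 0 L) (f : L2 L) :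
    integralUpTo L x f = ∫ t in (0 : ℝ)..x, f t := by
  rw [integralUpTo, innerSL_apply_apply, L2.inner_indicatorConstLp_one,
    Measure.restrict_restrict measurableSet_Ioo, intervalIntegral.integral_of_le hx.1,
    integral_Ioc_eq_integral_Ioo, inter_eq_left.2 (Ioo_subset_Ioo_right hx.2)]

/-- The functionals are represented by indicators of $(0,x)$, and the symmetric difference of
$(0,x)$ and $(0,y)$ has measure at most $|x-y|$. Continuity in $x$ makes the kernel of the Volterra
operator bounded and measurable. -/
theorem continuous_integralUpTo : Continuous (integralUpTo L) := by
  refine (innerSL ℂ).continuous.comp ?_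
  refine continuous_indicatorConstLp_set (by norm_num) fun x => ?_
  have h : Tendsto (fun y => ENNReal.ofReal |y - x|) (𝓝 x) (𝓝 0) := by
    have : Continuous fun y => ENNReal.ofReal |y - x| :=
      ENNReal.continuous_ofReal.comp (by fun_prop)
    simpa using this.tendsto x
  refine tendsto_of_tendsto_of_tendsto_of_le_of_le tendsto_const_nhds h (fun _ => zero_le)
    fun y => ?_
  refine (Measure.restrict_le_self _).trans ((measure_mono ?_).trans
    (Real.volume_interval (a := x) (b := y)).le)
  rintro t (⟨⟨h1, h2⟩, h3⟩ | ⟨⟨h1, h2⟩, h3⟩)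
  · exact mem_uIcc.2 (Or.inl ⟨not_lt.1 fun h => h3 ⟨h1, h⟩, h2.le⟩)
  · exact mem_uIcc.2 (Or.inr ⟨not_lt.1 fun h => h3 ⟨h1, h⟩, h2.le⟩)

theorem memLp_integralUpTo : MemLp (integralUpTo L) 2 (volume.restrict (Ioo 0 L)) := by
  obtain ⟨C, hC⟩ := isCompact_Icc.exists_bound_of_continuousOn
    (continuous_integralUpTo (L := L)).continuousOn (s := Icc 0 L)
  refine MemLp.of_bound continuous_integralUpTo.aestronglyMeasurable C ?_
  filter_upwards [ae_restrict_mem measurableSet_Ioo] with x hx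
  exact hC x (Ioo_subset_Icc_self hx)

/-- The Volterra operator `f ↦ (x ↦ ∫₀ˣ f)` on `L²(0, L)`. -/
def volterra (L : ℝ) : L2 L →L[ℂ] L2 L := kernelOperator memLp_integralUpTo.toLp

theorem isCompactOperator_volterra : IsCompactOperator (volterra L) :=
  isCompactOperator_kernelOperator _

theorem isContRep_volterra (f : L2 L) : IsContRep (volterra L f) fun x => ∫ t in (0 : ℝ)..x, f t := by
  constructor
  · refine ((continuous_integralUpTo (L := L)).clm_apply continuous_const).continuousOn.congr
      (f := fun x => integralUpTo L x f) fun x hx => ?_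
    exact (integralUpTo_apply hx f).symm
  · filter_upwards [kernelOperator_apply memLp_integralUpTo.toLp f,
      memLp_integralUpTo.coeFn_toLp (f := integralUpTo L), ae_restrict_mem measurableSet_Ioo]
      with x h1 h2 hx
    rw [volterra, h1, h2, integralUpTo_apply (Ioo_subset_Icc_self hx)]

/-- Integration by parts against a test function; the boundary terms vanish because $\varphi(L)=0$
and the primitive is $0$ at $0$. -/
theorem isWeakDeriv_volterra (hL : 0 < L) (f : L2 L) : IsWeakDeriv (volterra L f) f := by
  intro φ hφ
  have hc : Continuous (deriv φ) := hφ.1.continuous_deriv (by simp)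
  have hz : ∀ x ∉ Ioo 0 L, φ x = 0 := fun x hx =>
    image_eq_zero_of_notMem_tsupport fun h => hx (hφ.2.2 h)
  have h0L : (0 : ℝ) ∈ Icc 0 L := left_mem_Icc.2 hL.le
  have hLL : L ∈ Icc 0 L := right_mem_Icc.2 hL.le
  have hd : ∀ x, HasDerivAt (fun x => (φ x : ℂ)) ((deriv φ x : ℝ) : ℂ) x := fun x =>
    ((hφ.1.differentiable (by simp) x).hasDerivAt).ofReal_comp
  have hc' : Continuous fun x => ((deriv φ x : ℝ) : ℂ) := Complex.continuous_ofReal.comp hc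
  have h := integral_mul_add_mul_of_primitive (a := 0) (b := L) (f := fun x => ((deriv φ x : ℝ) : ℂ))
    (F := fun x => (φ x : ℂ)) (g := f) (G := fun x => ∫ t in (0 : ℝ)..x, f t)
    (hc'.intervalIntegrable _ _) (intervalIntegrable_L2 f h0L hLL)
    (fun x _ => by
      rw [intervalIntegral.integral_eq_sub_of_hasDerivAt (fun x _ => hd x)
        (hc'.intervalIntegrable _ _)]
      ring)
    (fun x _ => by simp)
  rw [hz L (by simp), intervalIntegral.integral_same, mul_zero, Complex.ofReal_zero, zero_mul,
    sub_zero, intervalIntegral.integral_of_le hL.le, integral_Ioc_eq_integral_Ioo] at h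
  have e1 : ∀ᵐ x ∂volume.restrict (Ioo 0 L), deriv φ x • volterra L f x
      = ((deriv φ x : ℝ) : ℂ) * ∫ t in (0 : ℝ)..x, f t := by
    filter_upwards [(isContRep_volterra f).2] with x hx
    rw [hx, Complex.real_smul]
  have e2 : ∀ x, φ x • f x = (φ x : ℂ) * f x := fun x => Complex.real_smul
  simp only [e2]
  rw [integral_congr_ae e1, ← sub_eq_zero, sub_neg_eq_add, ← integral_add, h]
  · exact (hφ.integrable_deriv_smul (volterra L f)).congr e1
  · exact (hφ.integrable_smul f).congr (Eventually.of_forall e2)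

theorem volterra_mem_sobolev (hL : 0 < L) {n : ℕ} {f : L2 L} (hf : f ∈ sobolev L n) :
    volterra L f ∈ sobolev L (n + 1) := ⟨f, hf, isWeakDeriv_volterra hL f⟩

theorem weakDeriv_volterra (hL : 0 < L) (f : L2 L) : weakDeriv (volterra L f) = f :=
  (isWeakDeriv_volterra hL f).weakDeriv_eq

theorem pointValue_volterra (hL : 0 < L) (f : L2 L) {x : ℝ} (hx : x ∈ Icc 0 L) :
    pointValue (volterra L f) x = integralUpTo L x f := by
  rw [(isContRep_volterra f).pointValue_eq hL hx, integralUpTo_apply hx]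

/-- The constant function `1` in `L²(0, L)`. -/
def oneL2 (L : ℝ) : L2 L := Lp.const 2 _ (1 : ℂ)

theorem isContRep_oneL2 : IsContRep (oneL2 L) fun _ => 1 :=
  ⟨continuousOn_const, Lp.coeFn_const _ _ _⟩

theorem isWeakDeriv_oneL2 (hL : 0 < L) : IsWeakDeriv (oneL2 L) 0 := by
  intro φ hφ
  have hz : ∀ x ∉ Ioo 0 L, φ x = 0 := fun x hx =>
    image_eq_zero_of_notMem_tsupport fun h => hx (hφ.2.2 h)
  have h : ∫ x in (0 : ℝ)..L, deriv φ x = 0 := by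
    rw [intervalIntegral.integral_deriv_eq_sub (fun x _ => hφ.1.differentiable (by simp) x)
      ((hφ.1.continuous_deriv (by simp)).intervalIntegrable _ _), hz L (by simp), hz 0 (by simp),
      sub_zero]
  rw [intervalIntegral.integral_of_le hL.le, integral_Ioc_eq_integral_Ioo] at h
  rw [integral_congr_ae (g := fun x => deriv φ x • (1 : ℂ)), integral_smul_const, h, zero_smul,
    integral_congr_ae (g := fun _ => (0 : ℂ)), integral_zero, neg_zero]
  · filter_upwards [Lp.coeFn_zero ℂ 2 (volume.restrict (Ioo 0 L))] with x hx using by rw [hx]; simp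
  · filter_upwards [isContRep_oneL2.2] with x hx using by rw [hx]

theorem isContRep_pointValue (hL : 0 < L) {f : L2 L} (hf : f ∈ sobolev L 1) :
    IsContRep f (pointValue f) := by
  obtain ⟨F, hF⟩ := exists_contRep_of_mem hL hf
  have h : ∀ x ∈ Icc 0 L, pointValue f x = F x := fun x hx => hF.pointValue_eq hL hx
  refine ⟨hF.1.congr h, ?_⟩
  filter_upwards [hF.2, ae_restrict_mem measurableSet_Ioo] with x h1 hx
  rw [h1, h x (Ioo_subset_Icc_self hx)]

/-- Both sides have the same weak derivative and the same value at $0$. -/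
theorem eq_volterra_add (hL : 0 < L) {f : L2 L} (hf : f ∈ sobolev L 1) :
    f = volterra L (weakDeriv f) + pointValue f 0 • oneL2 L := by
  have h0 : (0 : ℝ) ∈ Icc 0 L := left_mem_Icc.2 hL.le
  have hw := (isWeakDeriv_weakDeriv hf)
  have h1 : IsWeakDeriv (volterra L (weakDeriv f) + pointValue f 0 • oneL2 L)
      (weakDeriv f + pointValue f 0 • 0) :=
    (isWeakDeriv_volterra hL _).add ((isWeakDeriv_oneL2 hL).smul _)
  have hm : volterra L (weakDeriv f) + pointValue f 0 • oneL2 L ∈ sobolev L 1 := ⟨_, trivial, h1⟩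
  have hm' := (sobolev L 1).smul_mem (-1 : ℂ) hm
  rw [smul_zero, add_zero] at h1
  rw [← sub_eq_zero, sub_eq_add_neg, ← neg_one_smul ℂ]
  refine eq_zero_of_weakDeriv_eq_zero hL (add_mem hf hm') ?_ ?_
  · rw [(hw.add (h1.smul (-1))).weakDeriv_eq, neg_one_smul, add_neg_cancel]
  · rw [pointValue_add hL hf hm' h0, pointValue_smul hL _ hm h0,
      pointValue_add hL ⟨_, trivial, isWeakDeriv_volterra hL _⟩
        ((sobolev L 1).smul_mem _ ⟨_, trivial, isWeakDeriv_oneL2 hL⟩) h0,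
      pointValue_smul hL _ ⟨_, trivial, isWeakDeriv_oneL2 hL⟩ h0, pointValue_volterra hL _ h0,
      isContRep_oneL2.pointValue_eq hL h0, integralUpTo_apply h0]
    simp

/-- The fundamental theorem of calculus in `H¹(0, L)`. -/
theorem pointValue_eq_add_integral (hL : 0 < L) {f : L2 L} (hf : f ∈ sobolev L 1) {x : ℝ}
    (hx : x ∈ Icc 0 L) : pointValue f x = pointValue f 0 + ∫ t in (0 : ℝ)..x, weakDeriv f t := by
  conv_lhs => rw [eq_volterra_add hL hf]
  rw [pointValue_add hL ⟨_, trivial, isWeakDeriv_volterra hL _⟩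
      ((sobolev L 1).smul_mem _ ⟨_, trivial, isWeakDeriv_oneL2 hL⟩) hx,
    pointValue_smul hL _ ⟨_, trivial, isWeakDeriv_oneL2 hL⟩ hx, pointValue_volterra hL _ hx,
    isContRep_oneL2.pointValue_eq hL hx, integralUpTo_apply hx, mul_one, add_comm]

/-- Integration by parts in `H¹(0, L)`. -/
theorem inner_weakDeriv_add (hL : 0 < L) {f g : L2 L} (hf : f ∈ sobolev L 1)
    (hg : g ∈ sobolev L 1) :
    inner ℂ (weakDeriv f) g + inner ℂ f (weakDeriv g)
      = conj (pointValue f L) * pointValue g L - conj (pointValue f 0) * pointValue g 0 := by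
  have h0L : (0 : ℝ) ∈ Icc 0 L := left_mem_Icc.2 hL.le
  have hLL : L ∈ Icc 0 L := right_mem_Icc.2 hL.le
  have hi := intervalIntegrable_L2 (weakDeriv f) h0L hLL
  have h := integral_mul_add_mul_of_primitive (a := 0) (b := L) (f := fun x => conj (weakDeriv f x))
    (F := fun x => conj (pointValue f x)) (g := weakDeriv g) (G := pointValue g)
    (by
      rw [intervalIntegrable_iff] at hi ⊢
      exact (Complex.conjCLE.toContinuousLinearMap.integrable_comp hi))
    (intervalIntegrable_L2 _ h0L hLL)
    (fun x hx => by
      rw [uIcc_of_le hL.le] at hx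
      rw [pointValue_eq_add_integral hL hf hx, map_add, intervalIntegral.integral_of_le hx.1,
        intervalIntegral.integral_of_le hx.1, integral_conj])
    (fun x hx => by
      rw [uIcc_of_le hL.le] at hx
      exact pointValue_eq_add_integral hL hg hx)
  rw [← h, intervalIntegral.integral_of_le hL.le, integral_Ioc_eq_integral_Ioo, L2.inner_def,
    L2.inner_def, ← integral_add (L2.integrable_inner _ _) (L2.integrable_inner _ _)]
  refine integral_congr_ae ?_
  filter_upwards [(isContRep_pointValue hL hf).2, (isContRep_pointValue hL hg).2] with x h1 h2
  rw [RCLike.inner_apply, RCLike.inner_apply, h1, h2]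
  ring

end Volterra

/-! ### The compact inverse of the beam operator -/

section Inverse

theorem isCompactOperator_prod {E F G : Type*} [NormedAddCommGroup E] [NormedSpace ℂ E]
    [NormedAddCommGroup F] [NormedSpace ℂ F] [NormedAddCommGroup G] [NormedSpace ℂ G]
    {S : E →L[ℂ] F} {T : E →L[ℂ] G} (hS : IsCompactOperator S) (hT : IsCompactOperator T) :
    IsCompactOperator (S.prod T) := by
  have h := (hS.clm_comp (ContinuousLinearMap.inl ℂ F G)).add
    (hT.clm_comp (ContinuousLinearMap.inr ℂ F G))
  have e : ⇑(S.prod T) = ContinuousLinearMap.inl ℂ F G ∘ S + ContinuousLinearMap.inr ℂ F G ∘ T := by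
    funext x
    simp
  rwa [e]

/-- The operator sending `f` to its primitive that vanishes at `L`. -/
def volterraEnd (L : ℝ) : L2 L →L[ℂ] L2 L :=
  volterra L - (integralUpTo L L).smulRight (oneL2 L)

theorem isCompactOperator_volterraEnd {L : ℝ} : IsCompactOperator (volterraEnd L) :=
  isCompactOperator_volterra.sub (isCompactOperator_smulRight _ _)

theorem volterraEnd_apply {L : ℝ} (f : L2 L) :
    volterraEnd L f = volterra L f + (-integralUpTo L L f) • oneL2 L := by
  rw [neg_smul, ← sub_eq_add_neg]
  rfl

theorem isWeakDeriv_volterraEnd {L : ℝ} (hL : 0 < L) (f : L2 L) :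
    IsWeakDeriv (volterraEnd L f) f := by
  have h := (isWeakDeriv_volterra hL f).add
    ((isWeakDeriv_oneL2 hL).smul (-integralUpTo L L f))
  rwa [smul_zero, add_zero, ← volterraEnd_apply] at h

theorem oneL2_mem_sobolev {L : ℝ} (hL : 0 < L) (n : ℕ) : oneL2 L ∈ sobolev L n := by
  cases n with
  | zero => trivial
  | succ n => exact ⟨0, zero_mem _, isWeakDeriv_oneL2 hL⟩

theorem volterraEnd_mem_sobolev {L : ℝ} (hL : 0 < L) {n : ℕ} {f : L2 L} (hf : f ∈ sobolev L n) :
    volterraEnd L f ∈ sobolev L (n + 1) := ⟨f, hf, isWeakDeriv_volterraEnd hL f⟩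

theorem pointValue_oneL2 {L : ℝ} (hL : 0 < L) {x : ℝ} (hx : x ∈ Icc 0 L) :
    pointValue (oneL2 L) x = 1 := isContRep_oneL2.pointValue_eq hL hx

theorem pointValue_volterraEnd {L : ℝ} (hL : 0 < L) (f : L2 L) :
    pointValue (volterraEnd L f) L = 0 := by
  have hLL : L ∈ Icc 0 L := right_mem_Icc.2 hL.le
  rw [volterraEnd_apply, pointValue_add hL (volterra_mem_sobolev (n := 0) hL trivial)
    ((sobolev L 1).smul_mem _ (oneL2_mem_sobolev hL 1)) hLL,
    pointValue_smul hL _ (oneL2_mem_sobolev hL 1) hLL, pointValue_oneL2 hL hLL,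
    pointValue_volterra hL f hLL]
  ring

/-- An `H¹` function with vanishing derivative and vanishing value at `L` is zero. -/
theorem eq_zero_of_weakDeriv_eq_zero_of_end {L : ℝ} (hL : 0 < L) {f : L2 L}
    (hf : f ∈ sobolev L 1) (hd : weakDeriv f = 0) (h : pointValue f L = 0) : f = 0 := by
  refine eq_zero_of_weakDeriv_eq_zero hL hf hd ?_
  have h1 := eq_volterra_add hL hf
  have hLL : L ∈ Icc 0 L := right_mem_Icc.2 hL.le
  rw [hd, map_zero, zero_add] at h1
  rwa [h1, pointValue_smul hL _ (oneL2_mem_sobolev hL 1) hLL, pointValue_oneL2 hL hLL,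
    mul_one] at h

variable (p : BeamParams)

theorem volterra_volterra_mem_clamped (a : L2 p.L) :
    volterra p.L (volterra p.L a) ∈ clamped p := by
  refine ⟨volterra_mem_sobolev p.L_pos (volterra_mem_sobolev (n := 0) p.L_pos trivial), ?_, ?_⟩
  · rw [pointValue_volterra p.L_pos _ p.zero_mem, integralUpTo_apply p.zero_mem,
      intervalIntegral.integral_same]
  · rw [weakDeriv_volterra p.L_pos, pointValue_volterra p.L_pos _ p.zero_mem,
      integralUpTo_apply p.zero_mem, intervalIntegral.integral_same]

variable {p}

theorem weakDeriv_eq_volterra {f : L2 p.L} (hf : f ∈ clamped p) :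
    weakDeriv f = volterra p.L (weakDeriv^[2] f) := by
  obtain ⟨hf, h0, h1⟩ := hf
  have e := eq_volterra_add p.L_pos (weakDeriv_mem hf)
  rwa [h1, zero_smul, add_zero] at e

theorem eq_volterra_volterra {f : L2 p.L} (hf : f ∈ clamped p) :
    f = volterra p.L (volterra p.L (weakDeriv^[2] f)) := by
  have e := eq_volterra_add p.L_pos (sobolev_succ_le _ 1 hf.1)
  rwa [hf.2.1, zero_smul, add_zero, weakDeriv_eq_volterra hf] at e

variable (p) in
/-- The coordinates `[u, v, ξ] ↦ (u'', v, ξ)` of the energy space. -/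
def energyCoordsLinear : EnergySpace p ≃ₗ[ℂ] L2 p.L × L2 p.L × ℂ where
  toFun w := (weakDeriv^[2] w.u, w.v, w.ξ)
  map_add' w z := by
    rw [EnergySpace.u_add, iterate_weakDeriv_add 2 w.u_mem.1 z.u_mem.1]
    rfl
  map_smul' c w := by
    rw [EnergySpace.u_smul, iterate_weakDeriv_smul 2 c w.u_mem.1]
    rfl
  invFun y := EnergySpace.mk _ (volterra_volterra_mem_clamped p y.1) y.2.1 y.2.2
  left_inv w := EnergySpace.ext_iff_comp (eq_volterra_volterra w.u_mem).symm rfl rfl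
  right_inv y := by
    refine Prod.ext ?_ rfl
    show weakDeriv (weakDeriv (volterra p.L (volterra p.L y.1))) = y.1
    rw [weakDeriv_volterra p.L_pos, weakDeriv_volterra p.L_pos]

/-- Up to nonzero factors these are the components of the isometry `EnergySpace.toL2`. Continuity in
this direction suffices: both spaces are complete, so the inverse is continuous by the open mapping
theorem. -/
theorem continuous_energyCoordsLinear : Continuous (energyCoordsLinear p) := by
  have hT : Continuous (EnergySpace.toL2 (p := p)) :=
    (AddMonoidHomClass.isometry_of_norm EnergySpace.toL2 EnergySpace.norm_toL2).continuous
  have h1 := p.Λ_pos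
  have h2 := p.ρ_pos
  have h3 := p.J_pos
  have e : ∀ {r : ℝ}, 0 < r → ((√r : ℝ) : ℂ) ≠ 0 := fun hr =>
    Complex.ofReal_ne_zero.2 (Real.sqrt_ne_zero'.2 hr)
  have key : ∀ w, energyCoordsLinear p w =
      ((((√(p.Λ / 2) : ℝ) : ℂ)⁻¹ • (EnergySpace.toL2 w).fst),
        (((√(p.ρ / 2) : ℝ) : ℂ)⁻¹ • (EnergySpace.toL2 w).snd.fst),
        (((√(1 / (2 * p.J)) : ℝ) : ℂ)⁻¹ • (EnergySpace.toL2 w).snd.snd)) := by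
    intro w
    refine Prod.ext ?_ (Prod.ext ?_ ?_)
    · exact (inv_smul_smul₀ (e (by positivity)) _).symm
    · exact (inv_smul_smul₀ (e (by positivity)) _).symm
    · exact (inv_smul_smul₀ (e (by positivity)) _).symm
  rw [funext key]
  fun_prop

variable (p) in
/-- The coordinates `[u, v, ξ] ↦ (u'', v, ξ)` as a homeomorphism. -/
def energyCoords : EnergySpace p ≃L[ℂ] L2 p.L × L2 p.L × ℂ :=
  (energyCoordsLinear p).toContinuousLinearEquivOfContinuous continuous_energyCoordsLinear

variable (p) in
/-- The inverse of the beam operator, in the coordinates `(u'', v, ξ)`. -/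
def beamInverseCoords : L2 p.L × L2 p.L × ℂ →L[ℂ] L2 p.L × L2 p.L × ℂ :=
  -- For the target $[u,v,\xi]$ the new second derivative $a$ solves $a''=-(\rho/\Lambda)v$,
  -- $a'(L)=0$, $a(L)=-\xi/\Lambda$.
  (((volterraEnd p.L ∘L volterraEnd p.L) ∘L ((-(p.ρ / p.Λ : ℂ)) •
      (ContinuousLinearMap.fst ℂ _ _ ∘L ContinuousLinearMap.snd ℂ (L2 p.L) (L2 p.L × ℂ))))
    + ((-(p.Λ : ℂ)⁻¹) • (ContinuousLinearMap.snd ℂ _ _ ∘L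
      ContinuousLinearMap.snd ℂ (L2 p.L) (L2 p.L × ℂ))).smulRight (oneL2 p.L)).prod
  -- The new $v$ is $u$, recovered from $u''$ by integrating twice from $0$; the new $\xi$ is
  -- $Ju'(L)=J\int_0^Lu''$.
  (((volterra p.L ∘L volterra p.L) ∘L ContinuousLinearMap.fst ℂ _ _).prod
    (((p.J : ℂ) • integralUpTo p.L p.L) ∘L ContinuousLinearMap.fst ℂ _ _))

theorem isCompactOperator_beamInverseCoords : IsCompactOperator (beamInverseCoords p) := by
  refine isCompactOperator_prod (IsCompactOperator.add ?_ (isCompactOperator_smulRight _ _))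
    (isCompactOperator_prod ?_ (isCompactOperator_of_locallyCompactSpace_dom _))
  · exact (isCompactOperator_volterraEnd.comp_clm _).comp_clm _
  · exact (isCompactOperator_volterra.comp_clm _).comp_clm _

variable (p) in
/-- The inverse of the beam operator. -/
def beamInverse : EnergySpace p →L[ℂ] EnergySpace p :=
  (energyCoords p).symm.toContinuousLinearMap ∘L beamInverseCoords p ∘L
    (energyCoords p).toContinuousLinearMap

theorem isCompactOperator_beamInverse : IsCompactOperator (beamInverse p) :=
  (isCompactOperator_beamInverseCoords.comp_clm (energyCoords p).toContinuousLinearMap).clm_comp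
    (energyCoords p).symm.toContinuousLinearMap

/-- The equations $u''''=0$, $u'''(L)=0$, $u''(L)=0$ give $u'''=0$ and $u''=0$ by integrating back
from $L$, and clamping at $0$ gives $u=0$. Moreover $v=0$ forces $\xi=Jv'(L)=0$. -/
theorem beamOperator_apply_eq_zero (x : (beamOperator p).domain) (h : beamOperator p x = 0) :
    x = 0 := by
  obtain ⟨w, hw⟩ := x
  have hv : w.v = 0 := congrArg EnergySpace.u h
  have h4 : -(p.Λ / p.ρ : ℂ) • weakDeriv^[4] w.u = 0 := congrArg EnergySpace.v h
  have h2 : -(p.Λ : ℂ) * pointValue (weakDeriv^[2] w.u) p.L = 0 := congrArg EnergySpace.ξ h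
  have hΛ : (p.Λ : ℂ) ≠ 0 := Complex.ofReal_ne_zero.2 p.Λ_pos.ne'
  have hρ : (p.ρ : ℂ) ≠ 0 := Complex.ofReal_ne_zero.2 p.ρ_pos.ne'
  have h4' := (smul_eq_zero.1 h4).resolve_left (neg_ne_zero.2 (div_ne_zero hΛ hρ))
  have h2' := (mul_eq_zero.1 h2).resolve_left (neg_ne_zero.2 hΛ)
  have e3 : weakDeriv^[3] w.u = 0 :=
    eq_zero_of_weakDeriv_eq_zero_of_end p.L_pos (iterate_weakDeriv_mem 1 3 hw.1) h4' hw.2.2.2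
  have e2 : weakDeriv^[2] w.u = 0 :=
    eq_zero_of_weakDeriv_eq_zero_of_end p.L_pos
      (iterate_weakDeriv_mem 1 2 (sobolev_succ_le _ 3 hw.1)) e3 h2'
  refine Subtype.ext (EnergySpace.ext_iff_comp (eq_zero_of_clamped w.u_mem e2) hv ?_)
  show w.ξ = 0
  rw [hw.2.2.1, hv, IsWeakDeriv.zero.weakDeriv_eq, pointValue_zero p.L_pos p.L_mem, mul_zero]

theorem beamOperator_beamInverse (w : EnergySpace p) :
    ∃ h : beamInverse p w ∈ (beamOperator p).domain, beamOperator p ⟨beamInverse p w, h⟩ = w := by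
  have hL := p.L_pos
  have hΛ : (p.Λ : ℂ) ≠ 0 := Complex.ofReal_ne_zero.2 p.Λ_pos.ne'
  have hρ : (p.ρ : ℂ) ≠ 0 := Complex.ofReal_ne_zero.2 p.ρ_pos.ne'
  set h : L2 p.L := (-(p.ρ / p.Λ : ℂ)) • w.v with hh
  set c : ℂ := (-(p.Λ : ℂ)⁻¹) • w.ξ with hc
  set a : L2 p.L := volterraEnd p.L (volterraEnd p.L h) + c • oneL2 p.L with ha
  have hu : (beamInverse p w).u = volterra p.L (volterra p.L a) := rfl
  have hv : (beamInverse p w).v = w.u := (eq_volterra_volterra w.u_mem).symm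
  have hξ : (beamInverse p w).ξ = p.J * integralUpTo p.L p.L (weakDeriv^[2] w.u) := rfl
  have d2 : weakDeriv^[2] (beamInverse p w).u = a := by
    rw [hu]
    show weakDeriv (weakDeriv _) = a
    rw [weakDeriv_volterra hL, weakDeriv_volterra hL]
  have hWW : volterraEnd p.L (volterraEnd p.L h) ∈ sobolev p.L 2 :=
    volterraEnd_mem_sobolev hL (volterraEnd_mem_sobolev (n := 0) hL trivial)
  have h1 : c • oneL2 p.L ∈ sobolev p.L 2 :=
    (sobolev p.L 2).smul_mem _ (oneL2_mem_sobolev hL 2)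
  have ha2 : a ∈ sobolev p.L 2 := add_mem hWW h1
  have d3 : weakDeriv^[3] (beamInverse p w).u = volterraEnd p.L h := by
    rw [Function.iterate_succ_apply', d2, ha, weakDeriv_add (sobolev_succ_le _ 1 hWW)
      (sobolev_succ_le _ 1 h1), weakDeriv_smul _ (oneL2_mem_sobolev hL 1),
      (isWeakDeriv_volterraEnd hL _).weakDeriv_eq, (isWeakDeriv_oneL2 hL).weakDeriv_eq, smul_zero,
      add_zero]
  have d4 : weakDeriv^[4] (beamInverse p w).u = h := by
    rw [Function.iterate_succ_apply', d3, (isWeakDeriv_volterraEnd hL _).weakDeriv_eq]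
  have hdom : beamInverse p w ∈ (beamOperator p).domain := by
    refine ⟨?_, ?_, ?_, ?_⟩
    · rw [hu]
      exact volterra_mem_sobolev hL (volterra_mem_sobolev hL ha2)
    · rw [hv]
      exact w.u_mem
    · rw [hv, hξ, weakDeriv_eq_volterra w.u_mem, pointValue_volterra hL _ p.L_mem]
    · rw [d3, pointValue_volterraEnd hL]
  refine ⟨hdom, EnergySpace.ext_iff_comp hv ?_ ?_⟩
  · show -(p.Λ / p.ρ : ℂ) • weakDeriv^[4] (beamInverse p w).u = w.v
    rw [d4, hh, smul_smul, neg_mul_neg, div_mul_div_cancel₀ hρ, div_self hΛ, one_smul]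
  · show -(p.Λ : ℂ) * pointValue (weakDeriv^[2] (beamInverse p w).u) p.L = w.ξ
    rw [d2, ha, pointValue_add hL (sobolev_succ_le _ 1 hWW) (sobolev_succ_le _ 1 h1) p.L_mem,
      pointValue_volterraEnd hL, pointValue_smul hL _ (oneL2_mem_sobolev hL 1) p.L_mem,
      pointValue_oneL2 hL p.L_mem, hc, smul_eq_mul]
    field_simp
    ring

variable (p) in
theorem isInverseOf_beamInverse : IsInverseOf (beamOperator p) (beamInverse p) := by
  refine ⟨beamOperator_beamInverse, fun x => ?_⟩
  obtain ⟨h, e⟩ := beamOperator_beamInverse (beamOperator p x)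
  have := beamOperator_apply_eq_zero (⟨_, h⟩ - x) (by rw [LinearPMap.map_sub, e, sub_self])
  exact congrArg Subtype.val (sub_eq_zero.1 this)

end Inverse

/-! ### Green's formula and skew-symmetry of the beam operator -/

section SkewSymmetry

variable {p : BeamParams}

/-- Green's formula for the biharmonic operator with the boundary conditions of the beam. -/
theorem inner_second_weakDeriv {v u : L2 p.L} (hv : v ∈ clamped p) (hu : u ∈ sobolev p.L 4)
    (h3 : pointValue (weakDeriv^[3] u) p.L = 0) :
    inner ℂ (weakDeriv^[2] v) (weakDeriv^[2] u)
      = conj (pointValue (weakDeriv v) p.L) * pointValue (weakDeriv^[2] u) p.L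
        + inner ℂ v (weakDeriv^[4] u) := by
  -- In the two integrations by parts, clamping of $v$ kills the boundary terms at $0$ and
  -- $u'''(L)=0$ kills one at $L$; only $\overline{v'(L)}u''(L)$ survives.
  have h1 := inner_weakDeriv_add p.L_pos (weakDeriv_mem hv.1)
    (iterate_weakDeriv_mem 1 2 (sobolev_succ_le _ 3 hu))
  have h2 := inner_weakDeriv_add p.L_pos (sobolev_succ_le _ 1 hv.1) (iterate_weakDeriv_mem 1 3 hu)
  rw [h3, hv.2.1, mul_zero, map_zero, zero_mul, sub_zero] at h2
  rw [hv.2.2, map_zero, zero_mul, sub_zero] at h1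
  rw [← Function.iterate_succ_apply' weakDeriv] at h1 h2
  have e : weakDeriv (weakDeriv v) = weakDeriv^[2] v := rfl
  rw [e] at h1
  linear_combination h1 - h2

variable (p) in
-- Green's formula applied to both pairings cancels all integrals. The surviving boundary terms
-- cancel against the third component, since $\xi=Jv'(L)$ turns its weight $1/(2J)$ into $\Lambda/2$
-- after multiplication by $\Lambda$.
theorem isSkewSymmetric_beamOperator : IsSkewSymmetric (beamOperator p) := by
  rintro ⟨w, hw⟩ ⟨z, hz⟩
  have hΛ : (p.Λ : ℂ) ≠ 0 := Complex.ofReal_ne_zero.2 p.Λ_pos.ne'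
  have hρ : (p.ρ : ℂ) ≠ 0 := Complex.ofReal_ne_zero.2 p.ρ_pos.ne'
  have hJ : (p.J : ℂ) ≠ 0 := Complex.ofReal_ne_zero.2 p.J_pos.ne'
  have g1 := inner_second_weakDeriv hw.2.1 hz.1 hz.2.2.2
  have g2 := congrArg conj (inner_second_weakDeriv hz.2.1 hw.1 hw.2.2.2)
  simp only [map_add, map_mul, inner_conj_symm, Complex.conj_conj] at g2
  rw [EnergySpace.inner_eq, EnergySpace.inner_eq, EnergySpace.energyInner_eq,
    EnergySpace.energyInner_eq]
  show _ * inner ℂ (weakDeriv^[2] w.v) (weakDeriv^[2] z.u)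
      + _ * inner ℂ (-(p.Λ / p.ρ : ℂ) • weakDeriv^[4] w.u) z.v
      + _ * inner ℂ (-(p.Λ : ℂ) * pointValue (weakDeriv^[2] w.u) p.L) z.ξ
    = -(_ * inner ℂ (weakDeriv^[2] w.u) (weakDeriv^[2] z.v)
      + _ * inner ℂ w.v (-(p.Λ / p.ρ : ℂ) • weakDeriv^[4] z.u)
      + _ * inner ℂ w.ξ (-(p.Λ : ℂ) * pointValue (weakDeriv^[2] z.u) p.L))
  rw [g1, g2, inner_smul_left, inner_smul_right, RCLike.inner_apply, RCLike.inner_apply,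
    hw.2.2.1, hz.2.2.1]
  simp only [map_neg, map_mul, map_div₀, Complex.conj_ofReal]
  push_cast
  field_simp
  ring

/-- The vector $[0,0,1]$ violates $\xi=Jv'(L)$. -/
theorem beamDomain_ne_top : (beamOperator p).domain ≠ ⊤ := by
  intro h
  have hm : EnergySpace.mk 0 (zero_mem (clamped p)) 0 1 ∈ (beamOperator p).domain := by
    rw [h]
    trivial
  have h1 : (1 : ℂ) = p.J * pointValue (weakDeriv (0 : L2 p.L)) p.L := hm.2.2.1
  rw [IsWeakDeriv.zero.weakDeriv_eq, pointValue_zero p.L_pos p.L_mem, mul_zero] at h1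
  exact one_ne_zero h1

end SkewSymmetry

/-! ### Complex conjugation on Sobolev spaces and on solutions -/

section Conjugation

variable {L : ℝ}

theorem IsWeakDeriv.star {f g : L2 L} (h : IsWeakDeriv f g) : IsWeakDeriv (star f) (star g) := by
  intro φ hφ
  have key : ∀ (ψ : ℝ → ℝ) (k : L2 L), ∫ x in Ioo 0 L, ψ x • (Star.star k : L2 L) x
      = conj (∫ x in Ioo 0 L, ψ x • k x) := by
    intro ψ k
    rw [← integral_conj]
    refine integral_congr_ae ?_
    filter_upwards [Lp.coeFn_star k] with x hx
    rw [hx]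
    simp
  rw [key, key, h φ hφ, map_neg]

theorem IsContRep.star {f : L2 L} {F : ℝ → ℂ} (h : IsContRep f F) :
    IsContRep (star f) fun x => conj (F x) := by
  refine ⟨Complex.continuous_conj.comp_continuousOn h.1, ?_⟩
  filter_upwards [Lp.coeFn_star f, h.2] with x h1 h2
  rw [h1, Pi.star_apply, h2]
  rfl

theorem star_mem_sobolev {n : ℕ} {f : L2 L} (hf : f ∈ sobolev L n) : star f ∈ sobolev L n := by
  induction n generalizing f with
  | zero => trivial
  | succ n ih =>
    obtain ⟨g, hg, h⟩ := hf
    exact ⟨star g, ih hg, h.star⟩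

theorem iterate_weakDeriv_star (k : ℕ) {f : L2 L} (hf : f ∈ sobolev L k) :
    weakDeriv^[k] (star f) = star (weakDeriv^[k] f) := by
  induction k generalizing f with
  | zero => rfl
  | succ k ih =>
    rw [Function.iterate_succ_apply, Function.iterate_succ_apply,
      (isWeakDeriv_weakDeriv hf).star.weakDeriv_eq]
    exact ih (weakDeriv_mem hf)

theorem pointValue_star (hL : 0 < L) {f : L2 L} (hf : f ∈ sobolev L 1) {x : ℝ}
    (hx : x ∈ Icc 0 L) : pointValue (star f) x = conj (pointValue f x) :=
  (isContRep_pointValue hL hf).star.pointValue_eq hL hx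

theorem star_smul_add_smul (a b : ℝ) (f g : L2 L) :
    star ((a : ℂ) • f + (b : ℂ) • g) = (a : ℂ) • star f + (b : ℂ) • star g := by
  apply Lp.ext
  filter_upwards [Lp.coeFn_star ((a : ℂ) • f + (b : ℂ) • g), Lp.coeFn_add ((a : ℂ) • f) ((b : ℂ) • g),
    Lp.coeFn_smul (a : ℂ) f, Lp.coeFn_smul (b : ℂ) g,
    Lp.coeFn_add ((a : ℂ) • star f) ((b : ℂ) • star g), Lp.coeFn_smul (a : ℂ) (star f),
    Lp.coeFn_smul (b : ℂ) (star g), Lp.coeFn_star f, Lp.coeFn_star g]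
    with x h1 h2 h3 h4 h5 h6 h7 h8 h9
  rw [h1, Pi.star_apply, h2, h5, Pi.add_apply, Pi.add_apply, h3, h4, h6, h7, Pi.smul_apply,
    Pi.smul_apply, Pi.smul_apply, Pi.smul_apply, h8, h9, Pi.star_apply, Pi.star_apply]
  simp only [smul_eq_mul, star_add, star_mul', RCLike.star_def, Complex.conj_ofReal]

variable {p : BeamParams}

theorem SolvesEigenBVP.star {μ : ℂ} (hμ : μ.re = 0) {f : L2 p.L} (h : SolvesEigenBVP p μ f) :
    SolvesEigenBVP p μ (star f) := by
  obtain ⟨⟨h2, h20, h21⟩, h4, e, e3, eL⟩ := h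
  have hL := p.L_pos
  -- For imaginary $\mu$ the square is real, so the boundary value problem has real coefficients.
  have hμ2 : μ ^ 2 = ((-μ.im ^ 2 : ℝ) : ℂ) := by
    have : μ = μ.im * Complex.I := Complex.ext (by simp [hμ]) (by simp)
    rw [this, mul_pow, Complex.I_sq]
    simp
  have i1 : weakDeriv (Star.star f) = Star.star (weakDeriv f) :=
    iterate_weakDeriv_star 1 (sobolev_succ_le _ 1 h2)
  refine ⟨⟨star_mem_sobolev h2, ?_, ?_⟩, star_mem_sobolev h4, ?_, ?_, ?_⟩
  · rw [pointValue_star hL (sobolev_succ_le _ 1 h2) p.zero_mem, h20, map_zero]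
  · rw [i1, pointValue_star hL (weakDeriv_mem h2) p.zero_mem, h21, map_zero]
  · have := congrArg Star.star e
    rw [hμ2, ← Complex.ofReal_mul, star_smul_add_smul, ← iterate_weakDeriv_star 4 h4] at this
    rw [hμ2, ← Complex.ofReal_mul, this]
    apply Lp.ext
    filter_upwards [Lp.coeFn_star (0 : L2 p.L), Lp.coeFn_zero ℂ 2 (volume.restrict (Ioo 0 p.L))]
      with x h1 h2
    rw [h1, Pi.star_apply, h2, Pi.zero_apply, star_zero]
  · rw [iterate_weakDeriv_star 3 (sobolev_succ_le _ 3 h4),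
      pointValue_star hL (iterate_weakDeriv_mem 1 3 h4) p.L_mem, e3, map_zero]
  · have := congrArg conj eL
    rw [hμ2] at this ⊢
    rw [i1, pointValue_star hL (weakDeriv_mem h2) p.L_mem, iterate_weakDeriv_star 2 h2,
      pointValue_star hL (iterate_weakDeriv_mem 1 2 (sobolev_succ_le _ 3 h4)) p.L_mem]
    simpa only [map_add, map_mul, Complex.conj_ofReal, map_zero] using this

end Conjugation

/-! ### Eigenvectors as solutions of the boundary value problem -/

section BoundaryValueProblem

variable {p : BeamParams}

theorem beamOperator_apply_u (w : (beamOperator p).domain) :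
    (beamOperator p w).u = (w : EnergySpace p).v := rfl

theorem beamOperator_apply_v (w : (beamOperator p).domain) :
    (beamOperator p w).v = -(p.Λ / p.ρ : ℂ) • weakDeriv^[4] (w : EnergySpace p).u := rfl

theorem beamOperator_apply_ξ (w : (beamOperator p).domain) : (beamOperator p w).ξ
    = -(p.Λ : ℂ) * pointValue (weakDeriv^[2] (w : EnergySpace p).u) p.L := rfl

theorem eigenTriple_u (μ : ℂ) (f : clamped p) : (eigenTriple p μ f).u = f := rfl

theorem eigenTriple_v (μ : ℂ) (f : clamped p) : (eigenTriple p μ f).v = μ • (f : L2 p.L) := rfl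

theorem eigenTriple_ξ (μ : ℂ) (f : clamped p) :
    (eigenTriple p μ f).ξ = μ * p.J * pointValue (weakDeriv (f : L2 p.L)) p.L := rfl

theorem fourth_weakDeriv_iff {μ : ℂ} {f g : L2 p.L} :
    (p.ρ * μ ^ 2 : ℂ) • f + (p.Λ : ℂ) • g = 0 ↔ -(p.Λ / p.ρ : ℂ) • g = μ • μ • f := by
  have hρ : (p.ρ : ℂ) ≠ 0 := Complex.ofReal_ne_zero.2 p.ρ_pos.ne'
  have e1 : (p.ρ * μ ^ 2 : ℂ) • f = (p.ρ : ℂ) • μ • μ • f := by module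
  have e2 : (p.Λ : ℂ) • g = (p.ρ : ℂ) • ((p.Λ / p.ρ : ℂ) • g) := by
    rw [smul_smul, mul_div_cancel₀ _ hρ]
  rw [e1, e2, ← smul_add, smul_eq_zero_iff_right hρ, add_eq_zero_iff_neg_eq', neg_smul]

theorem eigenTriple_mem_eigenspace {μ : ℂ} {f : L2 p.L} (h : SolvesEigenBVP p μ f) :
    eigenTriple p μ ⟨f, h.1⟩ ∈ operatorEigenspace (beamOperator p) μ := by
  obtain ⟨h2, h4, e, e3, eL⟩ := h
  have hd : eigenTriple p μ ⟨f, h2⟩ ∈ (beamOperator p).domain := by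
    refine ⟨h4, (clamped p).smul_mem _ h2, ?_, e3⟩
    rw [eigenTriple_ξ, eigenTriple_v, weakDeriv_smul _ (sobolev_succ_le _ 1 h2.1),
      pointValue_smul p.L_pos _ (weakDeriv_mem h2.1) p.L_mem]
    ring
  refine ⟨hd, EnergySpace.ext_iff_comp ?_ ?_ ?_⟩
  · rw [beamOperator_apply_u, EnergySpace.u_smul, eigenTriple_v, eigenTriple_u]
  · rw [beamOperator_apply_v, EnergySpace.v_smul, eigenTriple_v, eigenTriple_u]
    exact fourth_weakDeriv_iff.1 e
  · rw [beamOperator_apply_ξ, EnergySpace.ξ_smul, eigenTriple_ξ, eigenTriple_u]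
    linear_combination -eL

theorem solvesEigenBVP_of_mem_eigenspace {μ : ℂ} {w : EnergySpace p}
    (h : w ∈ operatorEigenspace (beamOperator p) μ) :
    SolvesEigenBVP p μ w.u ∧ w = eigenTriple p μ ⟨w.u, w.u_mem⟩ := by
  obtain ⟨hw, e⟩ := h
  have hu := congrArg EnergySpace.u e
  have hv := congrArg EnergySpace.v e
  have hξ := congrArg EnergySpace.ξ e
  rw [beamOperator_apply_u, EnergySpace.u_smul] at hu
  rw [beamOperator_apply_v, EnergySpace.v_smul, hu] at hv
  rw [beamOperator_apply_ξ, EnergySpace.ξ_smul] at hξ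
  have hw3 := hw.2.2.1
  rw [hu, weakDeriv_smul _ (sobolev_succ_le _ 1 w.u_mem.1),
    pointValue_smul p.L_pos _ (weakDeriv_mem w.u_mem.1) p.L_mem] at hw3
  refine ⟨⟨w.u_mem, hw.1, fourth_weakDeriv_iff.2 hv, hw.2.2.2, ?_⟩,
    EnergySpace.ext_iff_comp rfl hu ?_⟩
  · rw [hw3] at hξ
    linear_combination -hξ
  · rw [hw3, eigenTriple_ξ]
    ring

/-- Passing to the first component identifies eigenvectors with solutions, so the solution set
inherits the linear structure of the eigenspace. -/
theorem solvesEigenBVP_iff {μ : ℂ} {f : L2 p.L} :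
    SolvesEigenBVP p μ f ↔ ∃ w ∈ operatorEigenspace (beamOperator p) μ, w.u = f := by
  constructor
  · exact fun h => ⟨_, eigenTriple_mem_eigenspace h, rfl⟩
  · rintro ⟨w, hw, rfl⟩
    exact (solvesEigenBVP_of_mem_eigenspace hw).1

theorem SolvesEigenBVP.add {μ : ℂ} {f g : L2 p.L} (hf : SolvesEigenBVP p μ f)
    (hg : SolvesEigenBVP p μ g) : SolvesEigenBVP p μ (f + g) := by
  obtain ⟨w, hw, rfl⟩ := solvesEigenBVP_iff.1 hf
  obtain ⟨z, hz, rfl⟩ := solvesEigenBVP_iff.1 hg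
  exact solvesEigenBVP_iff.2 ⟨w + z, add_mem hw hz, rfl⟩

theorem SolvesEigenBVP.smul {μ : ℂ} {f : L2 p.L} (c : ℂ) (hf : SolvesEigenBVP p μ f) :
    SolvesEigenBVP p μ (c • f) := by
  obtain ⟨w, hw, rfl⟩ := solvesEigenBVP_iff.1 hf
  exact solvesEigenBVP_iff.2 ⟨c • w, Submodule.smul_mem _ c hw, rfl⟩

/-- Only $\mu^2$ enters the problem; this allows one function to serve both $\mu_n$ and $\mu_{-n}$.
-/
theorem SolvesEigenBVP.neg_eigenvalue {μ : ℂ} {f : L2 p.L} (hf : SolvesEigenBVP p μ f) :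
    SolvesEigenBVP p (-μ) f := by
  rwa [SolvesEigenBVP, neg_sq]

/-- The solutions of `f' = κ f` in `H¹(0, L)` are multiples of the exponential. -/
theorem pointValue_of_weakDeriv_eq_smul {L : ℝ} (hL : 0 < L) {f : L2 L} (hf : f ∈ sobolev L 1)
    {κ : ℂ} (h : weakDeriv f = κ • f) {x : ℝ} (hx : x ∈ Icc 0 L) :
    pointValue f x = Complex.exp (κ * x) * pointValue f 0 := by
  have h0L : (0 : ℝ) ∈ Icc 0 L := left_mem_Icc.2 hL.le
  have hd : ∀ t : ℝ, HasDerivAt (fun t : ℝ => Complex.exp (-κ * t))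
      (Complex.exp (-κ * t) * -κ) t := fun t => by
    have h1 : HasDerivAt (fun z : ℂ => -κ * z) (-κ) (t : ℂ) := by
      simpa using (hasDerivAt_id (t : ℂ)).const_mul (-κ)
    exact h1.cexp.comp_ofReal
  have hc : Continuous fun t : ℝ => Complex.exp (-κ * t) * -κ := by fun_prop
  -- Integrating factor: the derivative of $e^{-\kappa t}f(t)$ vanishes almost everywhere.
  have key := integral_mul_add_mul_of_primitive (a := 0) (b := x) (f := weakDeriv f)
    (F := pointValue f) (g := fun t : ℝ => Complex.exp (-κ * t) * -κ)
    (G := fun t : ℝ => Complex.exp (-κ * t))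
    (intervalIntegrable_L2 _ h0L hx) (hc.intervalIntegrable _ _)
    (fun t ht => by
      rw [uIcc_of_le hx.1] at ht
      exact pointValue_eq_add_integral hL hf ⟨ht.1, ht.2.trans hx.2⟩)
    (fun t _ => by
      rw [intervalIntegral.integral_eq_sub_of_hasDerivAt (fun t _ => hd t)
        (hc.intervalIntegrable _ _)]
      ring)
  have hae : ∀ᵐ t ∂volume.restrict (Ioo 0 L), weakDeriv f t * Complex.exp (-κ * t)
      + pointValue f t * (Complex.exp (-κ * t) * -κ) = 0 := by
    rw [h]
    filter_upwards [Lp.coeFn_smul κ f, (isContRep_pointValue hL hf).2] with t h1 h2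
    rw [h1, Pi.smul_apply, h2, smul_eq_mul]
    ring
  rw [intervalIntegral.integral_of_le hx.1, integral_Ioc_eq_integral_Ioo,
    integral_congr_ae (ae_restrict_of_ae_restrict_of_subset (Ioo_subset_Ioo_right hx.2) hae),
    integral_zero] at key
  have e0 : Complex.exp (-κ * (0 : ℝ)) = 1 := by simp
  rw [e0, mul_one] at key
  rw [← sub_eq_zero.1 key.symm, mul_left_comm, ← Complex.exp_add]
  simp

/-- The combination of the derivatives of `f` that solves `G' = κ G` if `f'''' = κ⁴ f`. -/
def expPart {L : ℝ} (f : L2 L) (κ : ℂ) : L2 L :=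
  weakDeriv^[3] f + κ • weakDeriv^[2] f + κ ^ 2 • weakDeriv f + κ ^ 3 • f

section

variable {L : ℝ} {f : L2 L}

theorem expPart_mem (hf : f ∈ sobolev L 4) (κ : ℂ) : expPart f κ ∈ sobolev L 1 :=
  add_mem (add_mem (add_mem (iterate_weakDeriv_mem 1 3 hf)
    (Submodule.smul_mem _ _ (iterate_weakDeriv_mem 1 2 (sobolev_succ_le _ 3 hf))))
    (Submodule.smul_mem _ _ (weakDeriv_mem (sobolev_succ_le _ 2 (sobolev_succ_le _ 3 hf)))))
    (Submodule.smul_mem _ _ (sobolev_succ_le _ 1 (sobolev_succ_le _ 2 (sobolev_succ_le _ 3 hf))))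

/-- This is the factorization $D^4-\kappa^4=(D-\kappa)(D^3+\kappa D^2+\kappa^2D+\kappa^3)$. -/
theorem weakDeriv_expPart (hf : f ∈ sobolev L 4) {κ : ℂ} (h : weakDeriv^[4] f = κ ^ 4 • f) :
    weakDeriv (expPart f κ) = κ • expPart f κ := by
  have h3 := isWeakDeriv_weakDeriv (iterate_weakDeriv_mem 1 3 hf)
  have h2 := isWeakDeriv_weakDeriv (iterate_weakDeriv_mem 1 2 (sobolev_succ_le _ 3 hf))
  have h1 := isWeakDeriv_weakDeriv
    (iterate_weakDeriv_mem 1 1 (sobolev_succ_le _ 2 (sobolev_succ_le _ 3 hf)))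
  have h0 := isWeakDeriv_weakDeriv (n := 0)
    (sobolev_succ_le _ 1 (sobolev_succ_le _ 2 (sobolev_succ_le _ 3 hf)))
  rw [← Function.iterate_succ_apply' weakDeriv] at h1 h2 h3
  rw [Function.iterate_one] at h1
  rw [expPart, (((h3.add (h2.smul κ)).add (h1.smul (κ ^ 2))).add (h0.smul (κ ^ 3))).weakDeriv_eq,
    h]
  simp only [Nat.succ_eq_add_one, Nat.reduceAdd]
  module

theorem pointValue_expPart (hL : 0 < L) (hf : f ∈ sobolev L 4) (κ : ℂ) {x : ℝ}
    (hx : x ∈ Icc 0 L) : pointValue (expPart f κ) x = pointValue (weakDeriv^[3] f) x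
      + κ * pointValue (weakDeriv^[2] f) x + κ ^ 2 * pointValue (weakDeriv f) x
      + κ ^ 3 * pointValue f x := by
  have m3 := iterate_weakDeriv_mem 1 3 hf
  have m2 := iterate_weakDeriv_mem 1 2 (sobolev_succ_le _ 3 hf)
  have m1 := iterate_weakDeriv_mem 1 1 (sobolev_succ_le _ 2 (sobolev_succ_le _ 3 hf))
  have m0 := sobolev_succ_le _ 1 (sobolev_succ_le _ 2 (sobolev_succ_le _ 3 hf))
  have s2 := Submodule.smul_mem _ κ m2
  have s1 := Submodule.smul_mem _ (κ ^ 2) m1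
  have s0 := Submodule.smul_mem _ (κ ^ 3) m0
  have e := pointValue_add hL (add_mem (add_mem m3 s2) s1) s0 hx
  rw [pointValue_add hL (add_mem m3 s2) s1 hx, pointValue_add hL m3 s2 hx,
    pointValue_smul hL _ m2 hx, pointValue_smul hL _ m1 hx, pointValue_smul hL _ m0 hx] at e
  exact e

end

/-- A clamped solution of `f'''' = β⁴ f` with `f''(0) = f'''(L) = 0` vanishes. -/
theorem eq_zero_of_fourth_weakDeriv_eq {β : ℝ} (hβ : 0 < β) {f : L2 p.L} (hc : f ∈ clamped p)
    (hf : f ∈ sobolev p.L 4) (h : weakDeriv^[4] f = (β : ℂ) ^ 4 • f)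
    (h2 : pointValue (weakDeriv^[2] f) 0 = 0) (h3 : pointValue (weakDeriv^[3] f) p.L = 0) :
    f = 0 := by
  have hL := p.L_pos
  -- At $0$ the values of $f$, $f'$ and $f''$ vanish, so the initial value of `expPart f κ` is
  -- $f'''(0)$ for every root $\kappa$.
  have key : ∀ κ : ℂ, κ ^ 4 = (β : ℂ) ^ 4 → ∀ x ∈ Icc 0 p.L,
      pointValue (expPart f κ) x = Complex.exp (κ * x) * pointValue (weakDeriv^[3] f) 0 := by
    intro κ hκ x hx
    rw [pointValue_of_weakDeriv_eq_smul hL (expPart_mem hf κ)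
      (weakDeriv_expPart hf (by rw [hκ, h])) hx, pointValue_expPart hL hf κ p.zero_mem, h2,
      hc.2.1, hc.2.2]
    ring
  have hI4 : Complex.I ^ 4 = 1 := Complex.I_pow_four
  have hI2 := Complex.I_sq
  have hI3 : Complex.I ^ 3 = -Complex.I := Complex.I_pow_three
  have w2 : (-β : ℂ) ^ 4 = (β : ℂ) ^ 4 := by ring
  have w3 : (Complex.I * β) ^ 4 = (β : ℂ) ^ 4 := by rw [mul_pow, hI4, one_mul]
  have w4 : (-(Complex.I * β)) ^ 4 = (β : ℂ) ^ 4 := by rw [← w3]; ring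
  have h30 : pointValue (weakDeriv^[3] f) 0 = 0 := by
    have k1 := key β rfl p.L p.L_mem
    have k2 := key (-β) w2 p.L p.L_mem
    have k3 := key (Complex.I * β) w3 p.L p.L_mem
    have k4 := key (-(Complex.I * β)) w4 p.L p.L_mem
    rw [pointValue_expPart hL hf _ p.L_mem, h3] at k1 k2 k3 k4
    -- Summing at $L$ over the roots $\pm\beta,\pm i\beta$: the power sums of
    -- $\kappa,\kappa^2,\kappa^3$ vanish and $f'''(L)=0$, so the left side is zero.
    have hsum : (Complex.exp (β * p.L) + Complex.exp (-β * p.L) + Complex.exp (Complex.I * β * p.L)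
        + Complex.exp (-(Complex.I * β) * p.L)) * pointValue (weakDeriv^[3] f) 0 = 0 := by
      have e2 : (Complex.I * (β : ℂ)) ^ 2 = -(β : ℂ) ^ 2 := by rw [mul_pow, hI2]; ring
      linear_combination (-1 : ℂ) * (k1 + k2 + k3 + k4)
        + 2 * pointValue (weakDeriv f) p.L * e2
    refine (mul_eq_zero.1 hsum).resolve_left fun h0 => ?_
    have hcosh : Complex.exp (β * p.L) + Complex.exp (-β * p.L)
        = ((2 * Real.cosh (β * p.L) : ℝ) : ℂ) := by
      push_cast
      rw [Complex.cosh]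
      ring_nf
    have hcos : Complex.exp (Complex.I * β * p.L) + Complex.exp (-(Complex.I * β) * p.L)
        = ((2 * Real.cos (β * p.L) : ℝ) : ℂ) := by
      push_cast
      rw [Complex.cos]
      ring_nf
    rw [add_assoc _ _ (Complex.exp (-(Complex.I * β) * p.L)), hcosh, hcos, ← Complex.ofReal_add,
      Complex.ofReal_eq_zero] at h0
    -- The factor $2\cosh\beta L+2\cos\beta L$ is positive.
    have c1 : 1 < Real.cosh (β * p.L) := Real.one_lt_cosh.2 (mul_pos hβ hL).ne'
    have c2 := Real.neg_one_le_cos (β * p.L)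
    linarith
  have hzero : ∀ κ : ℂ, κ ^ 4 = (β : ℂ) ^ 4 → expPart f κ = 0 := by
    intro κ hκ
    apply Lp.ext
    filter_upwards [(isContRep_pointValue hL (expPart_mem hf κ)).2,
      Lp.coeFn_zero ℂ 2 (volume.restrict (Ioo 0 p.L)), ae_restrict_mem measurableSet_Ioo]
      with x h1 h2 hx
    rw [h1, h2, key κ hκ x (Ioo_subset_Icc_self hx), h30, mul_zero, Pi.zero_apply]
  have z1 := hzero β rfl
  have z2 := hzero (-β) w2
  have z3 := hzero (Complex.I * β) w3
  have z4 := hzero (-(Complex.I * β)) w4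
  -- With weights $\kappa$ the coefficients become $\sum\kappa$, $\sum\kappa^2$, $\sum\kappa^3$, all
  -- zero, and $\sum\kappa^4=4\beta^4$ in front of $f$.
  have hcomb : (β : ℂ) • expPart f β + (-β : ℂ) • expPart f (-β)
      + (Complex.I * β : ℂ) • expPart f (Complex.I * β)
      + (-(Complex.I * β) : ℂ) • expPart f (-(Complex.I * β)) = (4 * (β : ℂ) ^ 4) • f := by
    simp only [expPart]
    match_scalars
    · ring
    · linear_combination 2 * (β : ℂ) ^ 2 * hI2
    · ring
    · linear_combination 2 * (β : ℂ) ^ 4 * hI4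
  rw [z1, z2, z3, z4] at hcomb
  simp only [smul_zero, add_zero] at hcomb
  refine (smul_eq_zero.1 hcomb.symm).resolve_left ?_
  exact mul_ne_zero (by norm_num) (pow_ne_zero 4 (Complex.ofReal_ne_zero.2 hβ.ne'))

end BoundaryValueProblem

/-! ### Simplicity of the eigenvalues and real normalized eigenfunctions -/

section Simplicity

variable {p : BeamParams} {μ : ℂ}

theorem SolvesEigenBVP.fourth_weakDeriv {f : L2 p.L} (h : SolvesEigenBVP p μ f) :
    weakDeriv^[4] f = (-(p.ρ * μ ^ 2 / p.Λ) : ℂ) • f := by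
  have hΛ : (p.Λ : ℂ) ≠ 0 := Complex.ofReal_ne_zero.2 p.Λ_pos.ne'
  have e := h.2.2.1
  rw [← inv_smul_smul₀ hΛ (weakDeriv^[4] f), eq_neg_of_add_eq_zero_right e, smul_neg, smul_smul,
    neg_smul]
  congr 2
  ring

/-- A solution of the boundary value problem is determined by `f''(0)`. -/
theorem SolvesEigenBVP.eq_zero (hre : μ.re = 0) (hμ : μ ≠ 0) {f : L2 p.L}
    (h : SolvesEigenBVP p μ f) (h2 : pointValue (weakDeriv^[2] f) 0 = 0) : f = 0 := by
  have him : μ.im ≠ 0 := fun h => hμ (Complex.ext hre h)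
  have hpos : 0 < p.ρ * μ.im ^ 2 / p.Λ :=
    div_pos (mul_pos p.ρ_pos (by positivity)) p.Λ_pos
  -- The number $\beta$ is the positive fourth root of $-\rho\mu^2/\Lambda$, which is positive
  -- because $\mu$ is imaginary and nonzero.
  have hβ : (p.ρ * μ.im ^ 2 / p.Λ) = ((p.ρ * μ.im ^ 2 / p.Λ) ^ (1 / 4 : ℝ)) ^ 4 := by
    rw [← Real.rpow_mul_natCast hpos.le]
    norm_num
  refine eq_zero_of_fourth_weakDeriv_eq (Real.rpow_pos_of_pos hpos (1 / 4)) h.1 h.2.1 ?_ h2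
    h.2.2.2.1
  rw [h.fourth_weakDeriv, ← Complex.ofReal_pow, ← hβ]
  congr 1
  have hμ2 : μ ^ 2 = -(μ.im : ℂ) ^ 2 := by
    have : μ = μ.im * Complex.I := Complex.ext (by simp [hre]) (by simp)
    rw [this, mul_pow, Complex.I_sq]
    simp
  rw [hμ2]
  push_cast
  ring

/-- The functional $f\mapsto f''(0)$ is linear and injective on solutions, so the solution space is
at most one-dimensional. -/
theorem SolvesEigenBVP.exists_eq_smul (hre : μ.re = 0) (hμ : μ ≠ 0) {f g : L2 p.L}
    (hf : SolvesEigenBVP p μ f) (hg : SolvesEigenBVP p μ g) (hg0 : g ≠ 0) :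
    ∃ c : ℂ, f = c • g := by
  have hg2 : pointValue (weakDeriv^[2] g) 0 ≠ 0 := fun h => hg0 (hg.eq_zero hre hμ h)
  set c := pointValue (weakDeriv^[2] f) 0 / pointValue (weakDeriv^[2] g) 0 with hc
  refine ⟨c, ?_⟩
  have hs := hf.add (hg.smul (-c))
  have h0 := hs.eq_zero hre hμ (by
    rw [iterate_weakDeriv_add 2 hf.1.1 ((sobolev p.L 2).smul_mem _ hg.1.1),
      iterate_weakDeriv_smul 2 _ hg.1.1,
      pointValue_add p.L_pos (iterate_weakDeriv_mem 1 2 (sobolev_succ_le _ 3 hf.2.1))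
        (Submodule.smul_mem _ _ (iterate_weakDeriv_mem 1 2 (sobolev_succ_le _ 3 hg.2.1)))
        p.zero_mem,
      pointValue_smul p.L_pos _ (iterate_weakDeriv_mem 1 2 (sobolev_succ_le _ 3 hg.2.1))
        p.zero_mem, neg_mul, hc, div_mul_cancel₀ _ hg2, add_neg_cancel])
  rwa [neg_smul, ← sub_eq_add_neg, sub_eq_zero] at h0

/-- Nontrivial solutions can be chosen real-valued. -/
theorem SolvesEigenBVP.exists_real (hre : μ.re = 0) {f : L2 p.L} (hf : SolvesEigenBVP p μ f)
    (hf0 : f ≠ 0) : ∃ g : L2 p.L, SolvesEigenBVP p μ g ∧ g ≠ 0 ∧ IsRealValued g := by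
  -- Twice the real part of $f$ is a real solution; if it vanishes, $f$ is purely imaginary and $if$
  -- is real.
  by_cases h : f + Star.star f = 0
  · refine ⟨Complex.I • f, hf.smul _, smul_ne_zero Complex.I_ne_zero hf0, ?_⟩
    have h1 := Lp.coeFn_add f (Star.star f)
    rw [h] at h1
    filter_upwards [h1, Lp.coeFn_zero ℂ 2 (volume.restrict (Ioo 0 p.L)), Lp.coeFn_star f,
      Lp.coeFn_smul Complex.I f] with x a1 a2 a3 a4
    rw [a2, Pi.add_apply, a3] at a1
    have := congrArg Complex.re a1
    rw [a4]
    simp only [Pi.zero_apply, Complex.zero_re, Complex.add_re, Pi.star_apply, RCLike.star_def,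
      Complex.conj_re] at this
    rw [Pi.smul_apply, smul_eq_mul, Complex.I_mul_im]
    linarith
  · refine ⟨f + Star.star f, hf.add (hf.star hre), h, ?_⟩
    filter_upwards [Lp.coeFn_add f (Star.star f), Lp.coeFn_star f] with x a1 a2
    rw [a1, Pi.add_apply, a2]
    simp

/-- `u` is a real normalized solution of the boundary value problem for the simple eigenvalue
`μ`. -/
def IsEigenfunction (p : BeamParams) (μ : ℂ) (u : clamped p) : Prop :=
  IsRealValued (u : L2 p.L) ∧ SolvesEigenBVP p μ u ∧
    (∀ f : L2 p.L, SolvesEigenBVP p μ f → ∃ c : ℂ, f = c • (u : L2 p.L)) ∧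
    ‖eigenTriple p μ u‖ = 1 ∧
    operatorEigenspace (beamOperator p) μ = Submodule.span ℂ {eigenTriple p μ u}

theorem eigenTriple_smul (c : ℂ) (f : clamped p) :
    eigenTriple p μ (c • f) = c • eigenTriple p μ f := by
  refine EnergySpace.ext_iff_comp ?_ ?_ ?_
  · rw [EnergySpace.u_smul, eigenTriple_u, eigenTriple_u, Submodule.coe_smul]
  · rw [EnergySpace.v_smul, eigenTriple_v, eigenTriple_v, Submodule.coe_smul, smul_comm]
  · rw [EnergySpace.ξ_smul, eigenTriple_ξ, eigenTriple_ξ, Submodule.coe_smul,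
      weakDeriv_smul _ (sobolev_succ_le _ 1 f.2.1),
      pointValue_smul p.L_pos _ (weakDeriv_mem f.2.1) p.L_mem]
    ring

theorem norm_eigenTriple_neg (f : clamped p) :
    ‖eigenTriple p (-μ) f‖ = ‖eigenTriple p μ f‖ := by
  rw [← sq_eq_sq₀ (norm_nonneg _) (norm_nonneg _), EnergySpace.norm_sq_eq, EnergySpace.norm_sq_eq]
  simp only [eigenTriple_u, eigenTriple_v, eigenTriple_ξ, neg_smul, neg_mul, norm_neg]

theorem eigenspace_eq_span {u : clamped p} (hu : SolvesEigenBVP p μ u)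
    (h : ∀ f : L2 p.L, SolvesEigenBVP p μ f → ∃ c : ℂ, f = c • (u : L2 p.L)) :
    operatorEigenspace (beamOperator p) μ = Submodule.span ℂ {eigenTriple p μ u} := by
  refine le_antisymm (fun w hw => ?_)
    ((Submodule.span_singleton_le_iff_mem _ _).2 (eigenTriple_mem_eigenspace hu))
  obtain ⟨hs, e⟩ := solvesEigenBVP_of_mem_eigenspace hw
  obtain ⟨c, hc⟩ := h _ hs
  refine Submodule.mem_span_singleton.2 ⟨c, ?_⟩
  rw [← eigenTriple_smul, e]
  congr 1
  exact Subtype.ext hc.symm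

theorem exists_isEigenfunction (hz : operatorEigenspace (beamOperator p) μ ≠ ⊥) :
    ∃ u, IsEigenfunction p μ u := by
  have hre := (isSkewSymmetric_beamOperator p).re_eigenvalue hz
  have hμ := (isInverseOf_beamInverse p).ne_zero_of_eigenspace_ne_bot hz
  obtain ⟨w, hw, hw0⟩ := (Submodule.ne_bot_iff _).1 hz
  obtain ⟨hs, e⟩ := solvesEigenBVP_of_mem_eigenspace hw
  -- An eigenvector is the triple of its first component, so that component cannot vanish.
  have hu0 : w.u ≠ 0 := fun h => hw0 (by
    have h1 : (⟨w.u, w.u_mem⟩ : clamped p) = (0 : ℂ) • 0 := by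
      rw [smul_zero]
      exact Subtype.ext h
    rw [e, h1, eigenTriple_smul, zero_smul])
  obtain ⟨g, hg, hg0, hgr⟩ := hs.exists_real hre hu0
  set N := ‖eigenTriple p μ ⟨g, hg.1⟩‖ with hN
  have hN0 : N ≠ 0 := fun h => hg0 (congrArg EnergySpace.u (norm_eq_zero.1 h))
  have hNc : ((N⁻¹ : ℝ) : ℂ) ≠ 0 := Complex.ofReal_ne_zero.2 (inv_ne_zero hN0)
  have hsol : SolvesEigenBVP p μ ((((N⁻¹ : ℝ) : ℂ) • ⟨g, hg.1⟩ : clamped p) : L2 p.L) :=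
    hg.smul _
  have huniq : ∀ f : L2 p.L, SolvesEigenBVP p μ f →
      ∃ c : ℂ, f = c • ((((N⁻¹ : ℝ) : ℂ) • ⟨g, hg.1⟩ : clamped p) : L2 p.L) := fun f hf =>
    hf.exists_eq_smul hre hμ hsol (smul_ne_zero hNc hg0)
  refine ⟨((N⁻¹ : ℝ) : ℂ) • ⟨g, hg.1⟩, ?_, hsol, huniq, ?_, eigenspace_eq_span hsol huniq⟩
  · filter_upwards [hgr, Lp.coeFn_smul ((N⁻¹ : ℝ) : ℂ) g] with x h1 h2
    rw [Submodule.coe_smul, h2, Pi.smul_apply, smul_eq_mul, Complex.im_ofReal_mul, h1, mul_zero]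
  · rw [eigenTriple_smul, norm_smul, Complex.norm_real, Real.norm_of_nonneg (by positivity),
      ← hN, inv_mul_cancel₀ hN0]

theorem IsEigenfunction.neg {u : clamped p} (h : IsEigenfunction p μ u) :
    IsEigenfunction p (-μ) u := by
  obtain ⟨h1, h2, h3, h4, -⟩ := h
  have h3' : ∀ f : L2 p.L, SolvesEigenBVP p (-μ) f → ∃ c : ℂ, f = c • (u : L2 p.L) :=
    fun f hf => h3 f (neg_neg μ ▸ hf.neg_eigenvalue)
  exact ⟨h1, h2.neg_eigenvalue, h3', (norm_eigenTriple_neg u).trans h4,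
    eigenspace_eq_span h2.neg_eigenvalue h3'⟩

theorem IsEigenfunction.finrank_eigenspace {u : clamped p} (h : IsEigenfunction p μ u) :
    Module.finrank ℂ (operatorEigenspace (beamOperator p) μ) = 1 := by
  rw [h.2.2.2.2]
  refine finrank_span_singleton fun h0 => ?_
  have := h.2.2.2.1
  rw [h0, norm_zero] at this
  exact zero_ne_one this

theorem IsEigenfunction.eigenspace_ne_bot {u : clamped p} (h : IsEigenfunction p μ u) :
    operatorEigenspace (beamOperator p) μ ≠ ⊥ := fun h0 => by
  have := h.finrank_eigenspace
  rw [h0, finrank_bot] at this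
  exact zero_ne_one this

end Simplicity

/-! ### Symmetric enumeration of the spectrum -/

section Enumeration

/-- A countably infinite set of nonzero imaginary numbers that is symmetric about `0` can be
enumerated by the nonzero integers, compatibly with the symmetry. -/
theorem exists_symmetric_enumeration {S : Set ℂ} (hc : S.Countable) (hinf : S.Infinite)
    (hre : ∀ z ∈ S, z.re = 0) (h0 : (0 : ℂ) ∉ S) (hneg : ∀ z ∈ S, -z ∈ S) :
    ∃ μ : ℤ → ℂ, InjOn μ {n | n ≠ 0} ∧ μ '' {n | n ≠ 0} = S ∧ ∀ n, μ (-n) = -μ n := by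
  set P : Set ℂ := {z | z ∈ S ∧ 0 < z.im} with hP
  have hcover : S ⊆ P ∪ (fun z => -z) '' P := by
    intro z hz
    rcases lt_trichotomy z.im 0 with h | h | h
    · exact Or.inr ⟨-z, ⟨hneg z hz, by simpa using h⟩, neg_neg z⟩
    · have hz0 : z = 0 := Complex.ext (hre z hz) h
      exact absurd (hz0 ▸ hz) h0
    · exact Or.inl ⟨hz, h⟩
  have hPinf : P.Infinite := fun hf => hinf ((hf.union (hf.image _)).subset hcover)
  have hPc : P.Countable := hc.mono fun z hz => hz.1
  have : Countable P := hPc.to_subtype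
  have : Infinite P := hPinf.to_subtype
  obtain ⟨e⟩ : Nonempty (ℕ ≃ P) := nonempty_equiv_of_countable
  have hpos : ∀ k, 0 < (e k : ℂ).im := fun k => (e k).2.2
  -- Here `e` enumerates the points in the upper half-plane from $0$, hence the shift by one; the
  -- sign reflects them. At $n=0$ the value is $0$, so oddness holds for every integer.
  refine ⟨fun n => (n.sign : ℂ) * e (n.natAbs - 1), ?_, ?_, fun n => ?_⟩
  · intro m hm n hn h
    simp only [mem_ofPred_eq] at hm hn
    have hi := congrArg Complex.im h
    have p1 := hpos (m.natAbs - 1)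
    have p2 := hpos (n.natAbs - 1)
    have key : ∀ k : ℕ, ∀ l : ℕ, (e k : ℂ) = e l → k = l := fun k l h =>
      e.injective (Subtype.ext h)
    rcases lt_or_gt_of_ne hm with h1 | h1 <;> rcases lt_or_gt_of_ne hn with h2 | h2
    · simp only [Int.sign_eq_neg_one_of_neg h1, Int.sign_eq_neg_one_of_neg h2] at h
      have := key _ _ (by simpa using h)
      omega
    · simp [Int.sign_eq_neg_one_of_neg h1, Int.sign_eq_one_of_pos h2] at hi
      linarith
    · simp [Int.sign_eq_one_of_pos h1, Int.sign_eq_neg_one_of_neg h2] at hi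
      linarith
    · simp only [Int.sign_eq_one_of_pos h1, Int.sign_eq_one_of_pos h2] at h
      have := key _ _ (by simpa using h)
      omega
  · refine Subset.antisymm ?_ fun z hz => ?_
    · rintro _ ⟨n, hn, rfl⟩
      simp only [mem_ofPred_eq] at hn
      have hm := (e (n.natAbs - 1)).2.1
      rcases lt_or_gt_of_ne hn with h1 | h1
      · simpa [Int.sign_eq_neg_one_of_neg h1] using hneg _ hm
      · simpa [Int.sign_eq_one_of_pos h1] using hm
    · rcases hcover hz with h | ⟨w, h, rfl⟩
      · obtain ⟨k, hk⟩ := e.surjective ⟨z, h⟩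
        refine ⟨(k : ℤ) + 1, by simp only [mem_ofPred_eq]; omega, ?_⟩
        have h1 : ((k : ℤ) + 1).sign = 1 := Int.sign_eq_one_of_pos (by omega)
        have h2 : ((k : ℤ) + 1).natAbs - 1 = k := by omega
        simp only [h1, h2, hk]
        simp
      · obtain ⟨k, hk⟩ := e.surjective ⟨w, h⟩
        refine ⟨-((k : ℤ) + 1), by simp only [mem_ofPred_eq]; omega, ?_⟩
        have h1 : (-((k : ℤ) + 1)).sign = -1 := Int.sign_eq_neg_one_of_neg (by omega)
        have h2 : (-((k : ℤ) + 1)).natAbs - 1 = k := by omega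
        simp only [h1, h2, hk]
        simp
  · simp

end Enumeration

end EulerBernoulli

end

/-! ### The orthonormal basis of eigenvectors and the theorem -/

open EulerBernoulli in
theorem propositionA3 (p : EulerBernoulli.BeamParams) :
    EulerBernoulli.IsSkewAdjointOperator (EulerBernoulli.beamOperator p) ∧
    EulerBernoulli.HasCompactResolvent (EulerBernoulli.beamOperator p) ∧
    DiscreteTopology (EulerBernoulli.operatorSpectrum (EulerBernoulli.beamOperator p)) ∧
    (∀ z : ℂ, ¬ AccPt z (𝓟 (EulerBernoulli.operatorSpectrum (EulerBernoulli.beamOperator p)))) ∧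
    ∃ μ : ℤ → ℂ,
      Set.InjOn μ {n | n ≠ 0} ∧
      μ '' {n | n ≠ 0} = EulerBernoulli.operatorSpectrum (EulerBernoulli.beamOperator p) ∧
      (∀ n, n ≠ 0 → (μ n).re = 0 ∧ μ (-n) = (starRingEnd ℂ) (μ n) ∧
        Module.finrank ℂ
          (EulerBernoulli.operatorEigenspace (EulerBernoulli.beamOperator p) (μ n)) = 1) ∧
      ∃ u : ℤ → EulerBernoulli.clamped p,
        (∀ n, n ≠ 0 →
          EulerBernoulli.IsRealValued (u n : EulerBernoulli.L2 p.L) ∧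
          u (-n) = u n ∧
          EulerBernoulli.SolvesEigenBVP p (μ n) (u n) ∧
          (∀ f : EulerBernoulli.L2 p.L, EulerBernoulli.SolvesEigenBVP p (μ n) f →
            ∃ c : ℂ, f = c • (u n : EulerBernoulli.L2 p.L)) ∧
          ‖EulerBernoulli.eigenTriple p (μ n) (u n)‖ = 1 ∧
          EulerBernoulli.operatorEigenspace (EulerBernoulli.beamOperator p) (μ n) =
            Submodule.span ℂ {EulerBernoulli.eigenTriple p (μ n) (u n)}) ∧
        ∃ b : HilbertBasis {n : ℤ // n ≠ 0} ℂ (EulerBernoulli.EnergySpace p),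
          ∀ n : {n : ℤ // n ≠ 0}, b n = EulerBernoulli.eigenTriple p (μ n) (u n) := by
  have hA := isSkewSymmetric_beamOperator p
  have hR := isInverseOf_beamInverse p
  have hK := isCompactOperator_beamInverse (p := p)
  have hspec : ∀ z, z ∈ operatorSpectrum (beamOperator p) ↔
      operatorEigenspace (beamOperator p) z ≠ ⊥ := fun z => hR.mem_operatorSpectrum_iff hK
  have hacc := hA.not_accPt_operatorSpectrum hR hK
  have hdisc : DiscreteTopology (operatorSpectrum (beamOperator p)) :=
    discreteTopology_of_noAccPts fun z _ => hacc z
  have hfin : ∀ z, FiniteDimensional ℂ (operatorEigenspace (beamOperator p) z) := fun z => by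
    by_cases hz : operatorEigenspace (beamOperator p) z = ⊥
    · rw [hz]
      infer_instance
    · obtain ⟨u, hu⟩ := exists_isEigenfunction hz
      exact Module.finite_of_finrank_eq_succ hu.finrank_eigenspace
  -- A subspace of $\mathbb C$ is separable, and a separable discrete space is countable.
  have hcount : (operatorSpectrum (beamOperator p)).Countable :=
    Set.countable_coe_iff.1 (TopologicalSpace.separableSpace_iff_countable.1 inferInstance)
  obtain ⟨μ, hinj, himg, hneg⟩ := exists_symmetric_enumeration hcount
    (hA.infinite_operatorSpectrum hR hK beamDomain_ne_top hfin)
    (fun z hz => hA.re_eigenvalue ((hspec z).1 hz))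
    (fun h => hR.ne_zero_of_eigenspace_ne_bot ((hspec 0).1 h) rfl)
    (fun z hz => by
      obtain ⟨u, hu⟩ := exists_isEigenfunction ((hspec z).1 hz)
      exact (hspec _).2 hu.neg.eigenspace_ne_bot)
  have hne : ∀ n, n ≠ 0 → operatorEigenspace (beamOperator p) (μ n) ≠ ⊥ := fun n hn =>
    (hspec _).1 (himg ▸ mem_image_of_mem μ hn)
  have hex : ∀ n : ℤ, ∃ u, n ≠ 0 → IsEigenfunction p (μ n) u := fun n => by
    by_cases hn : n = 0
    · exact ⟨0, fun h => absurd hn h⟩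
    · obtain ⟨u, hu⟩ := exists_isEigenfunction (hne n hn)
      exact ⟨u, fun _ => hu⟩
  choose U hU using hex
  -- Indexing the choice by $|n|$ makes $u_{-n}=u_n$ hold by construction; being an eigenfunction
  -- passes from $\mu$ to $-\mu$.
  have hu : ∀ n, n ≠ 0 → IsEigenfunction p (μ n) (U |n|) := fun n hn => by
    have h := hU |n| (abs_ne_zero.2 hn)
    rcases abs_choice n with e | e
    · rwa [e] at h ⊢
    · rw [e, hneg] at h
      have := h.neg
      rwa [neg_neg, ← e] at this
  refine ⟨hA.isSkewAdjointOperator hR, hR.hasCompactResolvent hK, hdisc, hacc, μ, hinj, himg,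
    fun n hn => ⟨hA.re_eigenvalue (hne n hn), ?_, (hu n hn).finrank_eigenspace⟩,
    fun n => U |n|, fun n hn => ⟨(hu n hn).1, by simp only [abs_neg], (hu n hn).2⟩, ?_⟩
  · rw [hneg, conj_eq_neg_of_re_eq_zero (hA.re_eigenvalue (hne n hn))]
  have hmem : ∀ n, n ≠ 0 → eigenTriple p (μ n) (U |n|) ∈ operatorEigenspace (beamOperator p) (μ n) :=
    fun n hn => eigenTriple_mem_eigenspace (hu n hn).2.1
  have horth : Orthonormal ℂ fun n : {n : ℤ // n ≠ 0} => eigenTriple p (μ n) (U |(n : ℤ)|) :=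
    ⟨fun n => (hu n n.2).2.2.2.1, fun m n hmn => hA.inner_eq_zero
      (fun h => hmn (Subtype.ext (hinj m.2 n.2 h))) (hmem m m.2) (hmem n n.2)⟩
  -- Every nontrivial eigenspace is spanned by one of these vectors, so their span contains the
  -- total family of eigenspaces.
  have htotal : (Submodule.span ℂ (Set.range
      fun n : {n : ℤ // n ≠ 0} => eigenTriple p (μ n) (U |(n : ℤ)|)))ᗮ = ⊥ := by
    rw [eq_bot_iff, ← hA.orthogonal_iSup_eigenspaces hR hK]
    refine Submodule.orthogonal_le (iSup_le fun z => ?_)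
    by_cases hz : operatorEigenspace (beamOperator p) z = ⊥
    · rw [hz]
      exact bot_le
    · obtain ⟨n, hn, rfl⟩ : z ∈ μ '' {n | n ≠ 0} := himg ▸ (hspec z).2 hz
      rw [(hu n hn).2.2.2.2]
      exact Submodule.span_mono (singleton_subset_iff.2 ⟨⟨n, hn⟩, rfl⟩)
  exact ⟨HilbertBasis.mkOfOrthogonalEqBot horth htotal, fun n => by
    rw [HilbertBasis.coe_mkOfOrthogonalEqBot]⟩
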